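/- **Setting.** Let $\mathcal X$ be a set and $\mathcal A$ a finite set. Let $S\subset\mathbb R$ be a bounded Borel set, $m$ a Borel measure on $\mathbb R$ with $m(S)=1$, and $\Omega\subset\mathbb R^d$ a compact set with Lebesgue measure $\nu(\Omega)=1$. For every $x\in\mathcal X$, $a\in\mathcal A$, $w\in\Omega$ let $\phi(x,a,w,\cdot)$ be the cumulative distribution function of some $S$-valued random variable, with $(w,s)\mapsto\phi(x,a,w,s)$ measurable. Put $\mathcal K^{x,a}(w,r)=\int_S\phi(x,a,w,s)\phi(x,a,r,s)\,dm(s)$ and let $\mathcal L^{x,a}$ be the integral operator $(\mathcal L^{x,a}\theta)(w)=\int_\Omega\mathcal K^{x,a}(w,r)\theta(r)\,d\nu(r)$ on $L^2(\Omega,\nu)$. For a positive self-adjoint compact operator $T$ let $\lambda_1(T)\ge\lambda_2(T)\ge\dots\ge0$ be its eigenvalues in decreasing order, repeated according to multiplicity (and continued by $0$ if there are only finitely many positive ones), and let $\|\theta\|_T=\sqrt{\langle\theta,T\theta\rangle}$. **Eigendecay assumption.** The set $\{\mathcal L^{x,a}:x\in\mathcal X,a\in\mathcal A\}$ of bounded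 operators is convex, and there are $0<\gamma\le1$, $s_0<\infty$ and a sequence $(\tau_k)_{k\ge1}$ with $\sum_k\tau_k^\gamma\le s_0$, $\tau_k=O(1/k)$, and $\lambda_k(\mathcal L^{x,a})<\tau_k$ for all $k,x,a$. **Estimator.** Let $n\ge1$, let $(x_j,a_j)_{j=1}^n$ be fixed points of $\mathcal X\times\mathcal A$, and let $\mathcal U_{\mathcal D}=\sum_{j=1}^n\mathcal L^{x_j,a_j}$, with eigenvalues $\lambda_i=\lambda_i(\mathcal U_{\mathcal D})$ and corresponding orthonormal eigenfunctions $e_i$ (orthonormality being needed only for those with $\lambda_i>0$). Let $\varepsilon^*=n^{-2/(\gamma+2)}$ and let $N_{\varepsilon^*}$ be the smallest number such that $\lambda_i<n\varepsilon^*$ for all $i>N_{\varepsilon^*}$. Given observations $y_1,\dots,y_n\in\mathbb R$, put $$g_{\mathcal D}(w)=\int_S\sum_{j=1}^n\mathbb 1\{y_j\le s\}\,\phi(x_j,a_j,w,s)\,dm(s),\qquad \theta_{\mathcal D}=\sum_{i=1}^{N_{\varepsilon^*}}\frac1{\lambda_i}\langle g_{\mathcal D},e_i\rangle e_i ,$$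 and let $\hat\theta_{\mathcal D}$ be a minimizer of $\|\theta-\theta_{\mathcal D}\|_{\mathcal U_{\mathcal D}}^2$ over $\theta\in\mathcal C=\{\theta\in L^2(\Omega,\nu):\theta\ge0,\ \int_\Omega\theta\,d\nu=1,\ \|\theta\|_{L^2(\Omega,\nu)}\le M\}$. **Claim.** Let $0<\delta\le1$ and $M\in\mathbb R$. Then: 1. $\lambda_k(\mathcal U_{\mathcal D})\le n\tau_k$ for every $k$. 2. The data-dependent error term is bounded independently of $\mathcal D$: $$\mathcal E^\delta_{\mathcal D}(n):=\sqrt{2\Big(2\log\tfrac1\delta+\sum_{i=1}^{N_{\varepsilon^*}}\log(1+\lambda_i)\Big)}+n^{\frac{\gamma}{\gamma+2}}M\ \le\ \mathcal E_\delta(n):=2\sqrt{\log\tfrac1\delta}+\Big(2\sqrt{s_0\log(1+n)}+M\Big)n^{\frac{\gamma}{\gamma+2}} .$$ 3. Let $\theta^*\in\mathcal C$ and let $y_1,\dots,y_n$ be independent random variables such that $y_j$ has cumulative distribution function $s\mapsto F^*(x_j,a_j,s)=\int_\Omega\theta^*(w)\phi(x_j,a_j,w,s)\,d\nu(w)$.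 Then a minimizer $\hat\theta_{\mathcal D}$ always exists, and for any choice of the eigenfunctions and of the minimizer, with probability at least $1-\delta$, $$\|\hat\theta_{\mathcal D}-\theta^*\|_{\mathcal U_{\mathcal D}}\le\mathcal E_\delta(n).$$ -/

import Mathlib

open MeasureTheory

noncomputable section

namespace FunctionalRegression

/-! ### Eigenvalue sequences and eigenfunctions -/

section Spectral

variable {H : Type*} [NormedAddCommGroup H] [InnerProductSpace ℝ H]

/-- The `k`-th term (counting from `0`) of the decreasing sequence of eigenvalues of a positive
self-adjoint compact operator `T`, repeated according to multiplicity and continued by zeros when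
there are only finitely many positive eigenvalues: the largest `t ≥ 0` such that `t = 0` or there
are `k + 1` orthonormal eigenvectors whose eigenvalues are all at least `t`. -/
def eigenval (T : H →L[ℝ] H) (k : ℕ) : ℝ :=
  sSup {t : ℝ | t = 0 ∨ ∃ v : Fin (k + 1) → H, Orthonormal ℝ v ∧
    ∀ i, ∃ μ : ℝ, t ≤ μ ∧ T (v i) = μ • v i}

/-- `e` lists eigenfunctions of `T` corresponding to the eigenvalue sequence of `T`: `e k` belongs
to the `k`-th eigenvalue, and those belonging to nonzero eigenvalues are orthonormal. (When
`eigenval T k = 0`, the value `e k` plays no role in the spectral decomposition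
`T θ = ∑ λ_k ⟨θ, e_k⟩ e_k`, and it need not exist as a unit vector if `H` is finite
dimensional.) -/
structure IsEigenfunctions (T : H →L[ℝ] H) (e : ℕ → H) : Prop where
  orthonormal : Orthonormal ℝ (fun k : {k : ℕ // eigenval T k ≠ 0} => e k)
  apply_eq : ∀ k, T (e k) = eigenval T k • e k

/-- The smallest number `N` such that all eigenvalues after the first `N` are smaller
than `c`. -/
def truncIndex (T : H →L[ℝ] H) (c : ℝ) : ℕ :=
  sInf {N : ℕ | ∀ i, N ≤ i → eigenval T i < c}

/-- Pseudo-inverse of the operator obtained from `T` by keeping only the eigenvalues that are at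
least `c`: `θ ↦ ∑_{i < N} λ_i⁻¹ ⟨θ, e_i⟩ e_i`, with `N = truncIndex T c`. -/
def truncPinv (T : H →L[ℝ] H) (e : ℕ → H) (c : ℝ) (θ : H) : H :=
  ∑ i ∈ Finset.range (truncIndex T c), ((1 / eigenval T i) * inner ℝ θ (e i)) • e i

/-- The (semi)norm `‖θ‖_T = √⟨θ, T θ⟩` of a positive self-adjoint operator `T`. -/
def opNorm (T : H →L[ℝ] H) (θ : H) : ℝ :=
  Real.sqrt (inner ℝ θ (T θ))

end Spectral

/-! ### Integral operators with bounded kernels -/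

section IntegralOperator

variable {α : Type*} [MeasurableSpace α] (ν : Measure α) [IsFiniteMeasure ν]

theorem integrable_of_L2 (θ : Lp ℝ 2 ν) : Integrable (θ : α → ℝ) ν :=
  (Lp.memLp θ).integrable (by norm_num)

variable (K : α → α → ℝ)

theorem integrable_kernel_mul (hK : Measurable (Function.uncurry K)) (C : ℝ)
    (hC : ∀ w r, |K w r| ≤ C) (θ : Lp ℝ 2 ν) (w : α) :
    Integrable (fun r => K w r * θ r) ν := by
  refine (integrable_of_L2 ν θ).bdd_mul (c := C) ?_ ?_
  · exact (hK.comp measurable_prodMk_left).aestronglyMeasurable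
  · exact Filter.Eventually.of_forall fun r => hC w r

theorem abs_integral_kernel_le (hK : Measurable (Function.uncurry K)) (C : ℝ)
    (hC : ∀ w r, |K w r| ≤ C) (θ : Lp ℝ 2 ν) (w : α) :
    |∫ r, K w r * θ r ∂ν| ≤ C * ∫ r, |θ r| ∂ν := by
  rw [← integral_const_mul]
  refine (abs_integral_le_integral_abs).trans ?_
  refine integral_mono (integrable_kernel_mul ν K hK C hC θ w).abs
    ((integrable_of_L2 ν θ).abs.const_mul C) fun r => ?_
  simp only [abs_mul]
  exact mul_le_mul_of_nonneg_right (hC w r) (abs_nonneg _)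

theorem aestronglyMeasurable_integral_kernel (hK : Measurable (Function.uncurry K))
    (θ : Lp ℝ 2 ν) :
    AEStronglyMeasurable (fun w => ∫ r, K w r * θ r ∂ν) ν := by
  have h : StronglyMeasurable (Function.uncurry fun w r => K w r * θ r) :=
    hK.stronglyMeasurable.mul ((Lp.stronglyMeasurable θ).comp_measurable measurable_snd)
  exact h.integral_prod_right.aestronglyMeasurable

theorem memLp_integral_kernel (hK : Measurable (Function.uncurry K)) (C : ℝ)
    (hC : ∀ w r, |K w r| ≤ C) (θ : Lp ℝ 2 ν) :
    MemLp (fun w => ∫ r, K w r * θ r ∂ν) 2 ν :=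
  MemLp.of_bound (aestronglyMeasurable_integral_kernel ν K hK θ) (C * ∫ r, |θ r| ∂ν)
    (Filter.Eventually.of_forall fun w => abs_integral_kernel_le ν K hK C hC θ w)

/-- The integral operator `θ ↦ (w ↦ ∫ K(w, r) θ(r) dν(r))` on `L²(ν)` of a bounded measurable
kernel, as a linear map. -/
def integralLinearMap (hK : Measurable (Function.uncurry K)) (C : ℝ)
    (hC : ∀ w r, |K w r| ≤ C) : Lp ℝ 2 ν →ₗ[ℝ] Lp ℝ 2 ν where
  toFun θ := (memLp_integral_kernel ν K hK C hC θ).toLp _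
  map_add' θ η := by
    rw [← MemLp.toLp_add]
    congr 1
    funext w
    rw [Pi.add_apply, ← integral_add (integrable_kernel_mul ν K hK C hC θ w)
      (integrable_kernel_mul ν K hK C hC η w)]
    refine integral_congr_ae ?_
    filter_upwards [Lp.coeFn_add θ η] with r hr
    simp only [hr, Pi.add_apply]
    ring
  map_smul' c θ := by
    rw [RingHom.id_apply, ← MemLp.toLp_const_smul]
    congr 1
    funext w
    rw [Pi.smul_apply, smul_eq_mul, ← integral_const_mul]
    refine integral_congr_ae ?_
    filter_upwards [Lp.coeFn_smul c θ] with r hr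
    simp only [hr, Pi.smul_apply, smul_eq_mul]
    ring

theorem integralLinearMap_bound (hK : Measurable (Function.uncurry K)) (C : ℝ)
    (hC : ∀ w r, |K w r| ≤ C)
    [IsProbabilityMeasure ν] (θ : Lp ℝ 2 ν) (hC0 : 0 ≤ C) :
    ‖integralLinearMap ν K hK C hC θ‖ ≤ C * ‖θ‖ := by
  have h1 : ∫ r, |θ r| ∂ν ≤ ‖θ‖ := by
    have h := eLpNorm_le_eLpNorm_of_exponent_le (p := 1) (q := 2) (by norm_num)
      (Lp.aestronglyMeasurable θ) (μ := ν)
    have h2 := ENNReal.toReal_mono (Lp.eLpNorm_ne_top θ) h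
    rw [← Lp.norm_def, eLpNorm_one_eq_lintegral_enorm,
      ← integral_norm_eq_lintegral_enorm (Lp.aestronglyMeasurable θ)] at h2
    exact h2
  have h3 := Lp.norm_le_of_ae_bound (f := integralLinearMap ν K hK C hC θ)
    (C := C * ∫ r, |θ r| ∂ν) (by positivity) (by
      filter_upwards [(memLp_integral_kernel ν K hK C hC θ).coeFn_toLp] with w hw
      have : (integralLinearMap ν K hK C hC θ : α → ℝ) w = ∫ r, K w r * θ r ∂ν := hw
      rw [this]
      exact abs_integral_kernel_le ν K hK C hC θ w)
  simp only [measureUnivNNReal, measure_univ] at h3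
  simp only [ENNReal.toNNReal_one, NNReal.coe_one, Real.one_rpow, one_mul] at h3
  exact h3.trans (mul_le_mul_of_nonneg_left h1 hC0)

/-- The integral operator `θ ↦ (w ↦ ∫ K(w, r) θ(r) dν(r))` on `L²(ν)`, as a bounded operator. -/
def integralOperator (hK : Measurable (Function.uncurry K)) (C : ℝ)
    (hC : ∀ w r, |K w r| ≤ C)
    [IsProbabilityMeasure ν] (hC0 : 0 ≤ C) : Lp ℝ 2 ν →L[ℝ] Lp ℝ 2 ν :=
  (integralLinearMap ν K hK C hC).mkContinuous C
    fun θ => integralLinearMap_bound ν K hK C hC θ hC0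

end IntegralOperator

/-! ### The functional regression model -/

/-- A family `φ(x, a, w, ·)` of cumulative distribution functions of `S`-valued random variables,
indexed by a context `x`, an action `a` and a point `w` of a compact set `Ω ⊆ ℝ^d` of Lebesgue
measure one; `m` is a measure on the line with `m(S) = 1`. -/
structure CDFBasis (X A : Type*) (d : ℕ) where
  Om : Set (Fin d → ℝ)
  isCompact_Om : IsCompact Om
  volume_Om : volume Om = 1
  S : Set ℝ
  measurableSet_S : MeasurableSet S
  isBounded_S : Bornology.IsBounded S
  m : Measure ℝ
  m_S : m S = 1
  phi : X → A → Om → ℝ → ℝ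
  measurable_phi : ∀ x a, Measurable (fun p : Om × ℝ => phi x a p.1 p.2)
  isCDF : ∀ x a w, ∃ P : Measure ℝ, IsProbabilityMeasure P ∧ P Sᶜ = 0 ∧
    ∀ s, phi x a w s = P.real (Set.Iic s)

namespace CDFBasis

variable {X A : Type*} {d : ℕ} (B : CDFBasis X A d)

/-- The restriction of `m` to `S`. -/
abbrev mS : Measure ℝ := B.m.restrict B.S

/-- `d`-dimensional Lebesgue measure on `Ω`. -/
abbrev nu : Measure B.Om := (volume : Measure (Fin d → ℝ)).comap Subtype.val

/-- The Hilbert space `L²(Ω, ν)`. -/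
abbrev L2 : Type := Lp ℝ 2 B.nu

instance : IsProbabilityMeasure B.mS := ⟨by simp [B.m_S]⟩

instance : IsProbabilityMeasure B.nu :=
  ⟨by
    rw [(MeasurableEmbedding.subtype_coe B.isCompact_Om.measurableSet).comap_apply, Set.image_univ,
      Subtype.range_coe, B.volume_Om]⟩

theorem abs_phi_le (x : X) (a : A) (w : B.Om) (s : ℝ) : |B.phi x a w s| ≤ 1 := by
  obtain ⟨P, hP, -, h⟩ := B.isCDF x a w
  rw [h, abs_of_nonneg measureReal_nonneg]
  exact measureReal_le_one

/-- The kernel `𝒦^{x,a}(w, r) = ∫_S φ(x,a,w,s) φ(x,a,r,s) dm(s)`. -/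
def kernel (x : X) (a : A) (w r : B.Om) : ℝ :=
  ∫ s, B.phi x a w s * B.phi x a r s ∂B.mS

theorem measurable_kernel (x : X) (a : A) : Measurable (Function.uncurry (B.kernel x a)) := by
  have h : Measurable (Function.uncurry fun (p : B.Om × B.Om) (s : ℝ) =>
      B.phi x a p.1 s * B.phi x a p.2 s) :=
    ((B.measurable_phi x a).comp ((measurable_fst.comp measurable_fst).prodMk measurable_snd)).mul
      ((B.measurable_phi x a).comp ((measurable_snd.comp measurable_fst).prodMk measurable_snd))
  exact (h.stronglyMeasurable.integral_prod_right (ν := B.mS)).measurable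

theorem abs_kernel_le (x : X) (a : A) (w r : B.Om) : |B.kernel x a w r| ≤ 1 := by
  have h := norm_integral_le_of_norm_le_const (μ := B.mS) (C := 1)
    (f := fun s => B.phi x a w s * B.phi x a r s) (Filter.Eventually.of_forall fun s => by
      rw [Real.norm_eq_abs, abs_mul]
      exact mul_le_one₀ (B.abs_phi_le x a w s) (abs_nonneg _) (B.abs_phi_le x a r s))
  simpa [kernel] using h

/-- The integral operator `ℒ^{x,a}` on `L²(Ω, ν)` with kernel `𝒦^{x,a}`. -/
def opL (x : X) (a : A) : B.L2 →L[ℝ] B.L2 :=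
  integralOperator B.nu (B.kernel x a) (B.measurable_kernel x a) 1 (B.abs_kernel_le x a)
    zero_le_one

theorem coeFn_opL (x : X) (a : A) (θ : B.L2) :
    (B.opL x a θ : B.Om → ℝ) =ᵐ[B.nu] fun w => ∫ r, B.kernel x a w r * θ r ∂B.nu :=
  (memLp_integral_kernel B.nu (B.kernel x a) (B.measurable_kernel x a) 1
    (B.abs_kernel_le x a) θ).coeFn_toLp

/-- `F(x, a, s) = ∫_Ω θ(w) φ(x,a,w,s) dν(w)`. -/
def mixture (θ : B.L2) (x : X) (a : A) (s : ℝ) : ℝ :=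
  ∫ w, θ w * B.phi x a w s ∂B.nu

/-- The set of nonnegative `θ ∈ L²(Ω, ν)` with `∫ θ dν = 1` and `‖θ‖ ≤ M`. -/
def coeffSet (M : ℝ) : Set B.L2 :=
  {θ | 0 ≤ᵐ[B.nu] (θ : B.Om → ℝ) ∧ ∫ w, θ w ∂B.nu = 1 ∧ ‖θ‖ ≤ M}

/-- `γ`-dominating eigendecay with dominating sequence `τ` and `∑ τ_k^γ ≤ s₀`. The sequences are
indexed from `0`, so the condition
`τ_k = O(1/k)` reads `τ k ≤ C / (k + 1)`. -/
structure DominatingEigendecay (γ s₀ : ℝ) (τ : ℕ → ℝ) : Prop where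
  gamma_pos : 0 < γ
  gamma_le_one : γ ≤ 1
  convex : Convex ℝ (Set.range fun p : X × A => B.opL p.1 p.2)
  summable : Summable fun k => τ k ^ γ
  tsum_le : ∑' k, τ k ^ γ ≤ s₀
  eigenval_lt : ∀ x a k, eigenval (B.opL x a) k < τ k
  bigO : ∃ C : ℝ, ∀ k : ℕ, τ k ≤ C / (k + 1)

/-- The design integral operator `𝒰_𝒟 = ∑_j ℒ^{x_j,a_j}`. -/
def designOp {n : ℕ} (x : Fin n → X) (a : Fin n → A) : B.L2 →L[ℝ] B.L2 :=
  ∑ j, B.opL (x j) (a j)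

/-- `w ↦ ∫_S ∑_j 𝟙{y_j ≤ s} φ(x_j,a_j,w,s) dm(s)`. -/
def responseFun {n : ℕ} (x : Fin n → X) (a : Fin n → A) (y : Fin n → ℝ) (w : B.Om) : ℝ :=
  ∫ s, ∑ j, (Set.Ici (y j)).indicator (fun s => B.phi (x j) (a j) w s) s ∂B.mS

theorem memLp_responseFun {n : ℕ} (x : Fin n → X) (a : Fin n → A) (y : Fin n → ℝ) :
    MemLp (B.responseFun x a y) 2 B.nu := by
  have h : Measurable (Function.uncurry fun (w : B.Om) (s : ℝ) =>
      ∑ j, (Set.Ici (y j)).indicator (fun s => B.phi (x j) (a j) w s) s) := by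
    refine Finset.measurable_sum _ fun j _ => ?_
    have : (fun p : B.Om × ℝ => (Set.Ici (y j)).indicator (fun s => B.phi (x j) (a j) p.1 s) p.2)
        = (Prod.snd ⁻¹' Set.Ici (y j)).indicator (fun p => B.phi (x j) (a j) p.1 p.2) := by
      funext p
      simp [Set.indicator]
    exact this ▸ (B.measurable_phi (x j) (a j)).indicator (measurable_snd measurableSet_Ici)
  refine MemLp.of_bound
    (h.stronglyMeasurable.integral_prod_right (ν := B.mS)).aestronglyMeasurable n
    (Filter.Eventually.of_forall fun w => ?_)
  have h2 := norm_integral_le_of_norm_le_const (μ := B.mS) (C := n)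
    (f := fun s => ∑ j, (Set.Ici (y j)).indicator (fun s => B.phi (x j) (a j) w s) s)
    (Filter.Eventually.of_forall fun s => by
      refine (norm_sum_le _ _).trans ?_
      refine (Finset.sum_le_sum (g := fun _ => (1 : ℝ)) fun j _ => ?_).trans (by simp)
      exact (norm_indicator_le_norm_self _ _).trans (B.abs_phi_le (x j) (a j) w s))
  simpa [responseFun] using h2

/-- The truncation level `ε* = n^{-2/(γ+2)}`. -/
def epsStar (n : ℕ) (γ : ℝ) : ℝ := (n : ℝ) ^ (-(2 / (γ + 2)))

/-- The least squares estimate `θ_𝒟`: the pseudo-inverse of the truncated design operator (keeping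
the eigenvalues that are at least `n ε*`) applied to the response function. Here `e` are the
eigenfunctions used. -/
def thetaD {n : ℕ} (γ : ℝ) (x : Fin n → X) (a : Fin n → A) (e : ℕ → B.L2) (y : Fin n → ℝ) :
    B.L2 :=
  truncPinv (B.designOp x a) e (n * epsStar n γ) ((B.memLp_responseFun x a y).toLp _)

/-- The projections of `θ` onto the set `coeffSet M` in the seminorm `‖·‖_𝒰`: all minimizers
over that set of `z ↦ ‖z - θ‖_𝒰²`. -/
def projections (M : ℝ) (U : B.L2 →L[ℝ] B.L2) (θ : B.L2) : Set B.L2 :=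
  {z | z ∈ B.coeffSet M ∧ ∀ z' ∈ B.coeffSet M, opNorm U (z - θ) ^ 2 ≤ opNorm U (z' - θ) ^ 2}

/-- The data-dependent error term
`√(2 (2 log(1/δ) + ∑_{i ≤ N} log(1 + λ_i(𝒰_𝒟)))) + n^{γ/(γ+2)} M`, where `N` is the number of
eigenvalues kept at level `n ε*`. -/
def errorD {n : ℕ} (γ M δ : ℝ) (x : Fin n → X) (a : Fin n → A) : ℝ :=
  Real.sqrt (2 * (2 * Real.log (1 / δ) +
    ∑ i ∈ Finset.range (truncIndex (B.designOp x a) (n * epsStar n γ)),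
      Real.log (1 + eigenval (B.designOp x a) i))) + (n : ℝ) ^ (γ / (γ + 2)) * M

end CDFBasis

/-- The error bound `2 log(1/δ)^{1/2} + (2 √(s₀ log(1+n)) + M) n^{γ/(γ+2)}`. -/
def errorBound (γ s₀ M δ : ℝ) (n : ℕ) : ℝ :=
  2 * Real.sqrt (Real.log (1 / δ)) +
    (2 * Real.sqrt (s₀ * Real.log (1 + n)) + M) * (n : ℝ) ^ (γ / (γ + 2))

end FunctionalRegression

end

/-!
The operator `𝒰_𝒟 / n` is a convex combination of the operators `ℒ^{x,a}`, hence one of them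
(`DominatingEigendecay.exists_designOp_eq`). This gives `λ_k(𝒰_𝒟) ≤ n τ_k`, and, because
`ε* ^ γ` times the number of retained eigenvalues is at most `∑ τ_k ^ γ ≤ s₀`, the bound of the
data-dependent error term (`DominatingEigendecay.errorD_le`).

For the oracle inequality, `⟨θ, ℒ^{x,a} η⟩ = ∫_S F_θ F_η dm`, where `F_θ` is the mixture with
coefficients `θ`. Mixtures are inner products with fixed vectors, so this form is weakly
sequentially continuous. Together with weak sequential compactness of balls, this yields the
existence of the projection (`projections_nonempty`). It also shows that the form attains its
maximum on the unit ball of the orthogonal complement of the retained eigenfunctions; a nonzero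
maximum is an eigenvalue there, so it lies below the truncation level
(`inner_designOp_le_of_orthogonal`). No separate proof that `𝒰_𝒟` is compact is needed.

The error of the truncated estimate splits orthogonally into a bias term, at most
`n ε* ‖θ*‖² ≤ (n ^ (γ / (γ + 2)) M)²`, and a variance term `∑ η_i² / λ_i`, where `η_i` is the
component along `e_i` of the noise `g_𝒟 - 𝒰_𝒟 θ*`. Hoeffding's lemma and independence give
`E exp ⟨noise, β⟩ ≤ exp (⟨β, 𝒰_𝒟 β⟩ / 2)` (`lintegral_exp_inner_noise_le`). Averaging over Gaussian
coefficients of `β` of variances `1 / (1 + λ_i)` and applying Markov's inequality bounds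
`∑ η_i² / (1 + λ_i)` with probability at least `1 - δ` (`one_sub_le_measureReal_sum_sq_le`).
Since the retained eigenvalues are at least `n ε* ≥ 1`, this controls the variance term. Finally,
the projection onto a convex set does not increase the distance to its points
(`opNorm_projection_sub_le`).
-/

noncomputable section

namespace FunctionalRegression

/-! ### Eigenvalue sequences -/

section Spectral

variable {H : Type*} [NormedAddCommGroup H] [InnerProductSpace ℝ H]

theorem le_norm_of_orthonormal_eigenvectors (T : H →L[ℝ] H) {k : ℕ} {t : ℝ} {v : Fin (k + 1) → H}
    (hv : Orthonormal ℝ v) (h : ∀ i, ∃ μ : ℝ, t ≤ μ ∧ T (v i) = μ • v i) : t ≤ ‖T‖ := by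
  obtain ⟨μ, hμ, hT⟩ := h 0
  have h1 := T.le_opNorm (v 0)
  rw [hT, norm_smul, hv.1, mul_one, mul_one] at h1
  exact hμ.trans ((le_abs_self μ).trans h1)

theorem bddAbove_eigenval (T : H →L[ℝ] H) (k : ℕ) :
    BddAbove {t : ℝ | t = 0 ∨ ∃ v : Fin (k + 1) → H, Orthonormal ℝ v ∧
      ∀ i, ∃ μ : ℝ, t ≤ μ ∧ T (v i) = μ • v i} := by
  refine ⟨‖T‖, ?_⟩
  rintro t (rfl | ⟨v, hv, h⟩)
  · exact norm_nonneg T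
  · exact le_norm_of_orthonormal_eigenvectors T hv h

theorem eigenval_nonneg (T : H →L[ℝ] H) (k : ℕ) : 0 ≤ eigenval T k :=
  le_csSup (bddAbove_eigenval T k) (Or.inl rfl)

theorem eigenval_le_norm (T : H →L[ℝ] H) (k : ℕ) : eigenval T k ≤ ‖T‖ := by
  refine csSup_le ⟨0, Or.inl rfl⟩ ?_
  rintro t (rfl | ⟨v, hv, h⟩)
  · exact norm_nonneg T
  · exact le_norm_of_orthonormal_eigenvectors T hv h

theorem le_eigenval (T : H →L[ℝ] H) {k : ℕ} {t : ℝ} {v : Fin (k + 1) → H}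
    (hv : Orthonormal ℝ v) (h : ∀ i, ∃ μ : ℝ, t ≤ μ ∧ T (v i) = μ • v i) :
    t ≤ eigenval T k :=
  le_csSup (bddAbove_eigenval T k) (Or.inr ⟨v, hv, h⟩)

theorem eigenval_antitone (T : H →L[ℝ] H) : Antitone (eigenval T) := by
  refine antitone_nat_of_succ_le fun k => csSup_le ⟨0, Or.inl rfl⟩ ?_
  rintro t (rfl | ⟨v, hv, h⟩)
  · exact eigenval_nonneg T k
  · exact le_eigenval T (hv.comp _ (Fin.castSucc_injective _)) fun i => h i.castSucc

theorem eigenval_smul_le (T : H →L[ℝ] H) {c : ℝ} (hc : 0 < c) (k : ℕ) :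
    eigenval (c • T) k ≤ c * eigenval T k := by
  refine csSup_le ⟨0, Or.inl rfl⟩ ?_
  rintro t (rfl | ⟨v, hv, h⟩)
  · exact mul_nonneg hc.le (eigenval_nonneg T k)
  · rw [← div_le_iff₀' hc]
    refine le_eigenval T hv fun i => ?_
    obtain ⟨μ, hμ, hT⟩ := h i
    refine ⟨μ / c, div_le_div_of_nonneg_right hμ hc.le, ?_⟩
    have h2 : T (v i) = c⁻¹ • (c • T) (v i) := by
      rw [_root_.smul_apply, smul_smul, inv_mul_cancel₀ hc.ne', one_smul]
    rw [h2, hT, smul_smul, div_eq_inv_mul]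

theorem eigenval_lt_of_truncIndex_le (T : H →L[ℝ] H) {c : ℝ} (h : ∃ N, eigenval T N < c) {i : ℕ}
    (hi : truncIndex T c ≤ i) : eigenval T i < c := by
  obtain ⟨N, hN⟩ := h
  have hne : {N : ℕ | ∀ i, N ≤ i → eigenval T i < c}.Nonempty :=
    ⟨N, fun i hi => (eigenval_antitone T hi).trans_lt hN⟩
  exact Nat.sInf_mem hne i hi

theorem le_eigenval_of_lt_truncIndex (T : H →L[ℝ] H) {c : ℝ} {i : ℕ}
    (hi : i < truncIndex T c) : c ≤ eigenval T i := by
  by_contra! h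
  exact absurd (Nat.sInf_le (s := {N : ℕ | ∀ i, N ≤ i → eigenval T i < c})
    fun j hj => (eigenval_antitone T hj).trans_lt h) (not_le.2 hi)

/-- A vector `v` orthogonal to the retained eigenfunctions would, as an eigenvector with eigenvalue
at least `c`, give one more eigenvalue above the truncation level. -/
theorem eigenvalue_lt_of_orthogonal (T : H →L[ℝ] H) {c : ℝ} (h : ∃ N, eigenval T N < c)
    {e : ℕ → H}
    (he : Orthonormal ℝ fun i : Fin (truncIndex T c) => e i)
    (heT : ∀ i < truncIndex T c, T (e i) = eigenval T i • e i)
    {v : H} (hv : ‖v‖ = 1) (hev : ∀ i < truncIndex T c, inner ℝ (e i) v = 0) {μ : ℝ}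
    (hT : T v = μ • v) : μ < c := by
  by_contra! hμ
  refine absurd (eigenval_lt_of_truncIndex_le T h le_rfl) (not_lt.2 ?_)
  refine le_eigenval T (v := Fin.snoc (fun i : Fin (truncIndex T c) => e i) v) ?_ ?_
  · constructor
    · intro i
      refine Fin.lastCases ?_ (fun j => ?_) i
      · simpa using hv
      · simpa using he.1 j
    · intro i j
      refine Fin.lastCases ?_ (fun i => ?_) i <;> refine Fin.lastCases ?_ (fun j => ?_) j
      · simp
      · intro _
        simpa [real_inner_comm] using hev j j.2
      · intro _
        simpa using hev i i.2
      · intro hij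
        simpa using he.2 (fun h => hij (by rw [h]))
  · intro i
    refine Fin.lastCases ?_ (fun j => ?_) i
    · exact ⟨μ, hμ, by simpa using hT⟩
    · exact ⟨eigenval T j, le_eigenval_of_lt_truncIndex T j.2, by simpa using heT j j.2⟩

end Spectral

/-! ### Mixtures, Gram operators and eigenvalue bounds -/

namespace CDFBasis

variable {X A : Type*} {d : ℕ} (B : CDFBasis X A d)

theorem measurable_phi_left (x : X) (a : A) (s : ℝ) : Measurable fun w => B.phi x a w s :=
  (B.measurable_phi x a).comp measurable_prodMk_right

theorem measurable_phi_right (x : X) (a : A) (w : B.Om) : Measurable (B.phi x a w) :=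
  (B.measurable_phi x a).comp measurable_prodMk_left

theorem memLp_phi (x : X) (a : A) (s : ℝ) : MemLp (fun w => B.phi x a w s) 2 B.nu :=
  MemLp.of_bound (B.measurable_phi_left x a s).aestronglyMeasurable 1
    (Filter.Eventually.of_forall fun w => B.abs_phi_le x a w s)

/-- The function `w ↦ φ(x, a, w, s)` as an element of `L²(Ω, ν)`; the mixtures at `s` are the
inner products with it. -/
def phiL2 (x : X) (a : A) (s : ℝ) : B.L2 := (B.memLp_phi x a s).toLp _

theorem mixture_eq_inner (θ : B.L2) (x : X) (a : A) (s : ℝ) :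
    B.mixture θ x a s = inner ℝ θ (B.phiL2 x a s) := by
  rw [L2.inner_def]
  refine integral_congr_ae ?_
  filter_upwards [(B.memLp_phi x a s).coeFn_toLp] with w hw
  rw [phiL2, hw]
  simp [mul_comm]

theorem norm_phiL2_le (x : X) (a : A) (s : ℝ) : ‖B.phiL2 x a s‖ ≤ 1 := by
  have h := Lp.norm_le_of_ae_bound (f := B.phiL2 x a s) (C := 1) zero_le_one (by
    filter_upwards [(B.memLp_phi x a s).coeFn_toLp] with w hw
    rw [phiL2, hw]
    exact B.abs_phi_le x a w s)
  simpa [measureUnivNNReal] using h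

theorem abs_mixture_le (θ : B.L2) (x : X) (a : A) (s : ℝ) : |B.mixture θ x a s| ≤ ‖θ‖ := by
  rw [mixture_eq_inner]
  exact (abs_real_inner_le_norm _ _).trans
    (mul_le_of_le_one_right (norm_nonneg _) (B.norm_phiL2_le x a s))

theorem measurable_mixture (θ : B.L2) (x : X) (a : A) : Measurable (B.mixture θ x a) := by
  have h : StronglyMeasurable (Function.uncurry fun (s : ℝ) (w : B.Om) => θ w * B.phi x a w s) :=
    ((Lp.stronglyMeasurable θ).comp_measurable measurable_snd).mul
      ((B.measurable_phi x a).comp measurable_swap).stronglyMeasurable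
  exact h.integral_prod_right.measurable

/-- Fubini's theorem for a bounded weight on the line. -/
theorem integral_integral_phi_mul (x : X) (a : A) {k : ℝ → ℝ} (hk : Measurable k) {C : ℝ}
    (hC : ∀ s, |k s| ≤ C) (θ : B.L2) :
    ∫ w, (∫ s, k s * B.phi x a w s ∂B.mS) * θ w ∂B.nu = ∫ s, k s * B.mixture θ x a s ∂B.mS := by
  have hint : Integrable (Function.uncurry fun (w : B.Om) (s : ℝ) =>
      k s * B.phi x a w s * θ w) (B.nu.prod B.mS) := by
    refine ((integrable_of_L2 B.nu θ).comp_fst B.mS).bdd_mul (c := C) ?_ ?_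
    · exact ((hk.comp measurable_snd).mul (B.measurable_phi x a)).aestronglyMeasurable
    · refine Filter.Eventually.of_forall fun p => ?_
      rw [Real.norm_eq_abs, abs_mul]
      exact (mul_le_of_le_one_right (abs_nonneg _) (B.abs_phi_le x a _ _)).trans (hC _)
  calc ∫ w, (∫ s, k s * B.phi x a w s ∂B.mS) * θ w ∂B.nu
      = ∫ w, ∫ s, k s * B.phi x a w s * θ w ∂B.mS ∂B.nu := by
        simp only [integral_mul_const]
    _ = ∫ s, ∫ w, k s * B.phi x a w s * θ w ∂B.nu ∂B.mS := integral_integral_swap hint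
    _ = _ := by
        refine integral_congr_ae (Filter.Eventually.of_forall fun s => ?_)
        simp only [mixture, ← integral_const_mul]
        exact integral_congr_ae (Filter.Eventually.of_forall fun w => by ring)

/-- `ℒ^{x,a}` is the Gram operator of the map sending `θ` to the mixture `∫ θ φ(x, a, ·) dν`. -/
theorem inner_opL (x : X) (a : A) (θ η : B.L2) :
    inner ℝ (B.opL x a θ) η = ∫ s, B.mixture θ x a s * B.mixture η x a s ∂B.mS := by
  rw [← B.integral_integral_phi_mul x a (B.measurable_mixture θ x a) (B.abs_mixture_le θ x a) η,
    L2.inner_def]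
  refine integral_congr_ae ?_
  filter_upwards [B.coeFn_opL x a θ] with w hw
  have h := B.integral_integral_phi_mul x a (B.measurable_phi_right x a w) (B.abs_phi_le x a w) θ
  rw [hw]
  simp only [kernel, RCLike.inner_apply, conj_trivial]
  rw [h, mul_comm]
  congr 1
  exact integral_congr_ae (Filter.Eventually.of_forall fun s => mul_comm _ _)

theorem norm_opL_le (x : X) (a : A) : ‖B.opL x a‖ ≤ 1 :=
  ContinuousLinearMap.opNorm_le_bound _ zero_le_one fun θ =>
    integralLinearMap_bound B.nu (B.kernel x a) (B.measurable_kernel x a) 1 (B.abs_kernel_le x a) θ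
      zero_le_one

theorem inner_opL_self_nonneg (x : X) (a : A) (θ : B.L2) : 0 ≤ inner ℝ (B.opL x a θ) θ := by
  rw [inner_opL]
  exact integral_nonneg fun s => mul_self_nonneg _

theorem inner_opL_comm (x : X) (a : A) (θ η : B.L2) :
    inner ℝ (B.opL x a θ) η = inner ℝ θ (B.opL x a η) := by
  rw [real_inner_comm _ θ, inner_opL, inner_opL]
  simp only [mul_comm]

variable {n : ℕ} (x : Fin n → X) (a : Fin n → A)

theorem inner_designOp (θ η : B.L2) :
    inner ℝ (B.designOp x a θ) η = ∑ j, inner ℝ (B.opL (x j) (a j) θ) η := by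
  rw [designOp, _root_.sum_apply, sum_inner]

theorem inner_designOp_comm (θ η : B.L2) :
    inner ℝ (B.designOp x a θ) η = inner ℝ θ (B.designOp x a η) := by
  rw [real_inner_comm _ θ, inner_designOp, inner_designOp]
  refine Finset.sum_congr rfl fun j _ => ?_
  rw [inner_opL_comm, real_inner_comm]

theorem inner_designOp_self_nonneg (θ : B.L2) : 0 ≤ inner ℝ θ (B.designOp x a θ) := by
  rw [real_inner_comm, inner_designOp]
  exact Finset.sum_nonneg fun j _ => B.inner_opL_self_nonneg _ _ θ

/-- The response function of the observations, tested against `β`. -/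
theorem inner_responseFun (y : Fin n → ℝ) (β : B.L2) :
    inner ℝ ((B.memLp_responseFun x a y).toLp _) β =
      ∑ j, ∫ s, (Set.Ici (y j)).indicator 1 s * B.mixture β (x j) (a j) s ∂B.mS := by
  have hk : ∀ t : ℝ, Measurable ((Set.Ici t).indicator (1 : ℝ → ℝ)) := fun t =>
    measurable_one.indicator measurableSet_Ici
  have hC : ∀ t s : ℝ, |(Set.Ici t).indicator (1 : ℝ → ℝ) s| ≤ 1 := fun t s => by
    by_cases h : s ∈ Set.Ici t <;> simp [h]
  have hint : ∀ j w, Integrable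
      (fun s => (Set.Ici (y j)).indicator 1 s * B.phi (x j) (a j) w s) B.mS := fun j w => by
    refine Integrable.of_bound ((hk _).mul (B.measurable_phi_right _ _ w)).aestronglyMeasurable 1
      (Filter.Eventually.of_forall fun s => ?_)
    rw [Real.norm_eq_abs, abs_mul]
    exact mul_le_one₀ (hC _ _) (abs_nonneg _) (B.abs_phi_le _ _ _ _)
  have hsum : ∀ w, B.responseFun x a y w =
      ∑ j, ∫ s, (Set.Ici (y j)).indicator 1 s * B.phi (x j) (a j) w s ∂B.mS := fun w => by
    rw [← integral_finsetSum _ fun j _ => hint j w]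
    refine integral_congr_ae (Filter.Eventually.of_forall fun s => ?_)
    exact Finset.sum_congr rfl fun j _ => by simp [Set.indicator]
  have hbd : ∀ j w,
      ‖∫ s, (Set.Ici (y j)).indicator 1 s * B.phi (x j) (a j) w s ∂B.mS‖ ≤ 1 := fun j w => by
    have h := norm_integral_le_of_norm_le_const (μ := B.mS) (C := 1)
      (f := fun s => (Set.Ici (y j)).indicator 1 s * B.phi (x j) (a j) w s)
      (Filter.Eventually.of_forall fun s => by
        rw [Real.norm_eq_abs, abs_mul]
        exact mul_le_one₀ (hC _ _) (abs_nonneg _) (B.abs_phi_le _ _ _ _))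
    simpa using h
  have hmeas : ∀ j, StronglyMeasurable fun w =>
      ∫ s, (Set.Ici (y j)).indicator 1 s * B.phi (x j) (a j) w s ∂B.mS := fun j => by
    have h : StronglyMeasurable (Function.uncurry fun (w : B.Om) (s : ℝ) =>
        (Set.Ici (y j)).indicator 1 s * B.phi (x j) (a j) w s) :=
      (((hk _).comp measurable_snd).mul (B.measurable_phi _ _)).stronglyMeasurable
    exact h.integral_prod_right
  simp only [← B.integral_integral_phi_mul _ _ (hk _) (hC _) β]
  rw [← integral_finsetSum _ fun j _ => (integrable_of_L2 B.nu β).bdd_mul (c := 1)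
    (hmeas j).aestronglyMeasurable (Filter.Eventually.of_forall (hbd j)), L2.inner_def]
  refine integral_congr_ae ?_
  filter_upwards [(B.memLp_responseFun x a y).coeFn_toLp] with w hw
  rw [hw, hsum]
  simp [Finset.sum_mul, mul_comm]

variable {B x a} {γ s₀ : ℝ} {τ : ℕ → ℝ}

/-- By convexity of the set of operators, `𝒰_𝒟 / n` is again one of the operators `ℒ^{x,a}`. -/
theorem DominatingEigendecay.exists_designOp_eq (hτ : B.DominatingEigendecay γ s₀ τ)
    (hn : 0 < n) : ∃ x' a', B.designOp x a = (n : ℝ) • B.opL x' a' := by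
  have hn' : (n : ℝ) ≠ 0 := Nat.cast_ne_zero.2 hn.ne'
  have h := hτ.convex.sum_mem (t := Finset.univ) (w := fun _ : Fin n => (n : ℝ)⁻¹)
    (z := fun j => B.opL (x j) (a j)) (fun _ _ => by positivity) (by simp [hn'])
    (fun j _ => ⟨(x j, a j), rfl⟩)
  obtain ⟨⟨x', a'⟩, h⟩ := h
  refine ⟨x', a', ?_⟩
  change B.opL x' a' = _ at h
  rw [h, ← Finset.smul_sum, smul_smul, mul_inv_cancel₀ hn', one_smul, designOp]

theorem DominatingEigendecay.eigenval_designOp_le (hτ : B.DominatingEigendecay γ s₀ τ)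
    (hn : 0 < n) (k : ℕ) : eigenval (B.designOp x a) k ≤ n * τ k := by
  obtain ⟨x', a', h⟩ := hτ.exists_designOp_eq (x := x) (a := a) hn
  rw [h]
  exact (eigenval_smul_le _ (Nat.cast_pos.2 hn) k).trans
    (mul_le_mul_of_nonneg_left (hτ.eigenval_lt x' a' k).le (Nat.cast_nonneg n))

theorem eigenval_designOp_le_card (B : CDFBasis X A d) (x : Fin n → X) (a : Fin n → A) (k : ℕ) :
    eigenval (B.designOp x a) k ≤ n := by
  refine (eigenval_le_norm _ k).trans ((norm_sum_le _ _).trans ?_)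
  exact (Finset.sum_le_sum fun j _ => B.norm_opL_le (x j) (a j)).trans (by simp)

/-- Since `τ_k = O(1/k)`, the eigenvalues fall below every positive level, so that truncation
indices are not junk values. -/
theorem DominatingEigendecay.exists_eigenval_designOp_lt (hτ : B.DominatingEigendecay γ s₀ τ)
    (hn : 0 < n) {c : ℝ} (hc : 0 < c) : ∃ N, eigenval (B.designOp x a) N < c := by
  obtain ⟨C, hC⟩ := hτ.bigO
  have h : Filter.Tendsto (fun k : ℕ => (n : ℝ) * (C / (k + 1))) Filter.atTop (nhds 0) := by
    have := (tendsto_one_div_add_atTop_nhds_zero_nat (𝕜 := ℝ)).const_mul ((n : ℝ) * C)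
    rw [mul_zero] at this
    refine this.congr fun k => by ring
  obtain ⟨N, hN⟩ := (h.eventually_lt_const hc).exists
  exact ⟨N, ((hτ.eigenval_designOp_le hn N).trans
    (mul_le_mul_of_nonneg_left (hC N) (Nat.cast_nonneg n))).trans_lt hN⟩

/-- At level `n ε`, at most `s₀ ε^{-γ}` eigenvalues are kept, since each of them forces
`τ_k ≥ ε`. -/
theorem DominatingEigendecay.truncIndex_mul_le (hτ : B.DominatingEigendecay γ s₀ τ)
    (hn : 0 < n) {ε : ℝ} (hε : 0 < ε) :
    truncIndex (B.designOp x a) (n * ε) * ε ^ γ ≤ s₀ := by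
  have hτ0 : ∀ k, 0 ≤ τ k := fun k =>
    (eigenval_nonneg (B.opL (x ⟨0, hn⟩) (a ⟨0, hn⟩)) k).trans (hτ.eigenval_lt _ _ k).le
  calc truncIndex (B.designOp x a) (n * ε) * ε ^ γ
      = ∑ k ∈ Finset.range (truncIndex (B.designOp x a) (n * ε)), ε ^ γ := by simp
    _ ≤ ∑ k ∈ Finset.range (truncIndex (B.designOp x a) (n * ε)), τ k ^ γ := by
        refine Finset.sum_le_sum fun k hk => Real.rpow_le_rpow hε.le ?_ hτ.gamma_pos.le
        have h := (le_eigenval_of_lt_truncIndex _ (Finset.mem_range.1 hk)).trans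
          (hτ.eigenval_designOp_le hn k)
        exact le_of_mul_le_mul_left h (Nat.cast_pos.2 hn)
    _ ≤ ∑' k, τ k ^ γ :=
        hτ.summable.sum_le_tsum _ fun k _ => Real.rpow_nonneg (hτ0 k) γ
    _ ≤ s₀ := hτ.tsum_le

theorem epsStar_pos (hn : 0 < n) (γ : ℝ) : 0 < epsStar n γ :=
  Real.rpow_pos_of_pos (Nat.cast_pos.2 hn) _

theorem natCast_mul_epsStar (hn : 0 < n) (hγ : 0 < γ) :
    n * epsStar n γ = (n : ℝ) ^ (γ / (γ + 2)) := by
  have hn' : (0 : ℝ) < n := Nat.cast_pos.2 hn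
  rw [epsStar]
  nth_rewrite 1 [← Real.rpow_one (n : ℝ)]
  rw [← Real.rpow_add hn']
  congr 1
  field_simp
  ring

theorem one_le_natCast_mul_epsStar (hn : 0 < n) (hγ : 0 < γ) : 1 ≤ n * epsStar n γ := by
  rw [natCast_mul_epsStar hn hγ]
  exact Real.one_le_rpow (by exact_mod_cast hn) (by positivity)

theorem DominatingEigendecay.errorD_le (hτ : B.DominatingEigendecay γ s₀ τ) (hn : 0 < n)
    (M : ℝ) {δ : ℝ} (hδ0 : 0 < δ) (hδ1 : δ ≤ 1) :
    B.errorD γ M δ x a ≤ errorBound γ s₀ M δ n := by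
  have hγ := hτ.gamma_pos
  have hn' : (0 : ℝ) < n := Nat.cast_pos.2 hn
  set N := truncIndex (B.designOp x a) (n * epsStar n γ) with hN
  set R := (n : ℝ) ^ (γ / (γ + 2)) with hR
  have hL : 0 ≤ Real.log (1 / δ) := Real.log_nonneg (by rw [le_div_iff₀ hδ0]; simpa using hδ1)
  have hlog : 0 ≤ Real.log (1 + n) := Real.log_nonneg (by linarith)
  have hR0 : 0 < R := Real.rpow_pos_of_pos hn' _
  have hNle : (N : ℝ) ≤ s₀ * R ^ 2 := by
    have h := hτ.truncIndex_mul_le (x := x) (a := a) hn (epsStar_pos hn γ)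
    have h2 : epsStar n γ ^ γ * R ^ 2 = 1 := by
      rw [epsStar, ← Real.rpow_mul hn'.le, hR, ← Real.rpow_natCast, ← Real.rpow_mul hn'.le,
        ← Real.rpow_add hn']
      convert Real.rpow_zero (n : ℝ) using 2
      push_cast
      ring
    calc (N : ℝ) = N * epsStar n γ ^ γ * R ^ 2 := by rw [mul_assoc, h2, mul_one]
      _ ≤ s₀ * R ^ 2 := mul_le_mul_of_nonneg_right h (sq_nonneg R)
  have hs₀ : 0 ≤ s₀ := by
    by_contra! h
    have := mul_neg_of_neg_of_pos h (pow_pos hR0 2)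
    linarith [(Nat.cast_nonneg N : (0 : ℝ) ≤ N)]
  have hsum : ∑ i ∈ Finset.range N, Real.log (1 + eigenval (B.designOp x a) i) ≤
      s₀ * R ^ 2 * Real.log (1 + n) := by
    calc _ ≤ ∑ i ∈ Finset.range N, Real.log (1 + n) :=
          Finset.sum_le_sum fun i _ => Real.log_le_log
            (by linarith [eigenval_nonneg (B.designOp x a) i])
            (by linarith [eigenval_designOp_le_card B x a i])
      _ = N * Real.log (1 + n) := by simp
      _ ≤ _ := mul_le_mul_of_nonneg_right hNle hlog
  have h1 : Real.sqrt (2 * (2 * Real.log (1 / δ) +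
      ∑ i ∈ Finset.range N, Real.log (1 + eigenval (B.designOp x a) i))) ≤
      2 * Real.sqrt (Real.log (1 / δ)) + 2 * Real.sqrt (s₀ * Real.log (1 + n)) * R := by
    refine Real.sqrt_le_iff.2 ⟨by positivity, ?_⟩
    have e1 := Real.sq_sqrt hL
    have e2 := Real.sq_sqrt (mul_nonneg hs₀ hlog)
    have e3 : 0 ≤ Real.sqrt (Real.log (1 / δ)) * (Real.sqrt (s₀ * Real.log (1 + n)) * R) := by
      positivity
    have e4 : 0 ≤ s₀ * R ^ 2 * Real.log (1 + n) := by positivity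
    calc _ ≤ 4 * Real.log (1 / δ) + 4 * (s₀ * Real.log (1 + n)) * R ^ 2 := by linarith
      _ ≤ _ := by
        nth_rewrite 1 [← e1, ← e2]
        linarith
  rw [errorD, errorBound, ← hN, ← hR]
  linarith

end CDFBasis

/-! ### Weak compactness and quadratic forms -/

section Hilbert

open Filter Topology

variable {H : Type*} [NormedAddCommGroup H] [InnerProductSpace ℝ H]

/-- Bounded sequences in a separable Hilbert space have weakly convergent subsequences. -/
theorem exists_subseq_tendsto_inner [CompleteSpace H] [TopologicalSpace.SeparableSpace H]
    {z : ℕ → H} {R : ℝ} (hz : ∀ k, ‖z k‖ ≤ R) :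
    ∃ z₀ : H, ‖z₀‖ ≤ R ∧ ∃ φ : ℕ → ℕ, StrictMono φ ∧
      ∀ v, Tendsto (fun k => inner ℝ (z (φ k)) v) atTop (𝓝 (inner ℝ z₀ v)) := by
  have h := WeakDual.isSeqCompact_closedBall ℝ H (0 : StrongDual ℝ H) R
  obtain ⟨f, hf, φ, hφ, hlim⟩ := h (x := fun k =>
    StrongDual.toWeakDual (InnerProductSpace.toDual ℝ H (z k))) fun k => by
      simpa using hz k
  refine ⟨(InnerProductSpace.toDual ℝ H).symm (WeakDual.toStrongDual f), ?_, φ, hφ, fun v => ?_⟩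
  · simpa using hf
  · have h2 := ((WeakDual.eval_continuous v).tendsto f).comp hlim
    rw [InnerProductSpace.toDual_symm_apply]
    exact h2.congr fun k => by simp

/-- Cauchy–Schwarz for a positive semidefinite form on a subspace: its isotropic vectors are in its
kernel. -/
theorem apply_eq_of_inner_eq {T : H →L[ℝ] H} (hT : ∀ u v, inner ℝ (T u) v = inner ℝ u (T v))
    {W : Submodule ℝ H} (hW : ∀ u ∈ W, T u ∈ W) {μ : ℝ}
    (hμ : ∀ u ∈ W, inner ℝ u (T u) ≤ μ * ‖u‖ ^ 2) {v : H} (hv : v ∈ W)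
    (h : inner ℝ v (T v) = μ * ‖v‖ ^ 2) : T v = μ • v := by
  set r := μ • v - T v with hr
  have hrW : r ∈ W := W.sub_mem (W.smul_mem _ hv) (hW v hv)
  -- the form at `v + t • r` is a nonnegative quadratic in `t` without constant term
  have key : ∀ t : ℝ, 0 ≤ (μ * ‖r‖ ^ 2 - inner ℝ r (T r)) * (t * t) + 2 * ‖r‖ ^ 2 * t + 0 := by
    intro t
    have h1 := hμ (v + t • r) (W.add_mem hv (W.smul_mem _ hrW))
    have h2 : inner ℝ r (T v) = μ * inner ℝ r v - ‖r‖ ^ 2 := by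
      have : T v = μ • v - r := by rw [hr]; abel
      rw [this, inner_sub_right, inner_smul_right, real_inner_self_eq_norm_sq]
    have h3 : inner ℝ v (T r) = μ * inner ℝ r v - ‖r‖ ^ 2 := by
      rw [← hT, real_inner_comm, h2]
    rw [← real_inner_self_eq_norm_sq (v + t • r)] at h1
    simp only [map_add, map_smul, inner_add_left, inner_add_right, inner_smul_left,
      inner_smul_right, conj_trivial, h, h2, h3, real_inner_self_eq_norm_sq,
      real_inner_comm r v] at h1
    linarith
  have hd := discrim_le_zero key
  rw [discrim] at hd
  have hr0 : ‖r‖ ^ 2 = 0 := by nlinarith [sq_nonneg (‖r‖ ^ 2)]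
  have : r = 0 := by simpa using hr0
  rw [hr, sub_eq_zero] at this
  exact this.symm

/-- A symmetric operator whose quadratic form is weakly sequentially continuous, and hence attains
its maximum on the unit ball of an invariant subspace, is bounded there by its eigenvalues. -/
theorem inner_le_of_eigenvalue_lt [CompleteSpace H] [TopologicalSpace.SeparableSpace H]
    {T : H →L[ℝ] H} (hT : ∀ u v, inner ℝ (T u) v = inner ℝ u (T v))
    (hcont : ∀ (z : ℕ → H) (z₀ : H) (R : ℝ), (∀ k, ‖z k‖ ≤ R) →
      (∀ v, Tendsto (fun k => inner ℝ (z k) v) atTop (𝓝 (inner ℝ z₀ v))) →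
      Tendsto (fun k => inner ℝ (z k) (T (z k))) atTop (𝓝 (inner ℝ z₀ (T z₀))))
    {K : Submodule ℝ H} (hK : ∀ u ∈ Kᗮ, T u ∈ Kᗮ) {c : ℝ} (hc : 0 ≤ c)
    (hev : ∀ v ∈ Kᗮ, ‖v‖ = 1 → ∀ μ : ℝ, T v = μ • v → μ < c) {u : H} (hu : u ∈ Kᗮ) :
    inner ℝ u (T u) ≤ c * ‖u‖ ^ 2 := by
  by_contra! hlt
  set S : Set ℝ := (fun u : H => inner ℝ u (T u)) '' {u | u ∈ Kᗮ ∧ ‖u‖ ≤ 1} with hS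
  have hne : S.Nonempty := ⟨_, 0, ⟨Kᗮ.zero_mem, by simp⟩, rfl⟩
  have hbdd : BddAbove S := by
    refine ⟨‖T‖, ?_⟩
    rintro _ ⟨v, ⟨-, hv⟩, rfl⟩
    have h1 : ‖T v‖ ≤ ‖T‖ := T.unit_le_opNorm v hv
    exact (real_inner_le_norm v (T v)).trans (by nlinarith [norm_nonneg v, norm_nonneg (T v)])
  obtain ⟨t, -, ht, htS⟩ := exists_seq_tendsto_sSup hne hbdd
  choose z hz hzt using htS
  obtain ⟨z₀, hz₀, φ, hφ, hlim⟩ := exists_subseq_tendsto_inner fun k => (hz k).2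
  have hz₀K : z₀ ∈ Kᗮ := by
    intro k hk
    rw [real_inner_comm]
    refine tendsto_nhds_unique (hlim k) (tendsto_const_nhds.congr fun m => ?_)
    rw [real_inner_comm]
    exact ((hz _).1 k hk).symm
  have hmax : inner ℝ z₀ (T z₀) = sSup S := by
    refine tendsto_nhds_unique (hcont _ z₀ 1 (fun k => (hz _).2) hlim) ?_
    exact (ht.comp hφ.tendsto_atTop).congr fun k => (hzt _).symm
  have hle : ∀ v ∈ Kᗮ, inner ℝ v (T v) ≤ sSup S * ‖v‖ ^ 2 := by
    intro v hv
    rcases eq_or_ne v 0 with rfl | hv0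
    · simp
    · have hn : ‖v‖ ≠ 0 := norm_ne_zero_iff.2 hv0
      have h1 := le_csSup hbdd
        ⟨‖v‖⁻¹ • v, ⟨Kᗮ.smul_mem _ hv, by simp [norm_smul, hn]⟩, rfl⟩
      simp only [map_smul, inner_smul_left, inner_smul_right, conj_trivial] at h1
      calc inner ℝ v (T v) = ‖v‖⁻¹ * (‖v‖⁻¹ * inner ℝ v (T v)) * ‖v‖ ^ 2 := by field_simp
        _ ≤ _ := mul_le_mul_of_nonneg_right h1 (sq_nonneg _)
  have hμc : c < sSup S := by
    by_contra! h
    exact absurd (hlt.trans_le (hle u hu)) (not_lt.2 (mul_le_mul_of_nonneg_right h (sq_nonneg _)))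
  have hnorm : ‖z₀‖ = 1 := by
    refine le_antisymm hz₀ ?_
    have h1 := hle z₀ hz₀K
    rw [hmax] at h1
    have h2 : 1 ≤ ‖z₀‖ ^ 2 := by
      by_contra! h
      nlinarith
    by_contra! h
    nlinarith [norm_nonneg z₀]
  have hT₀ : T z₀ = sSup S • z₀ :=
    apply_eq_of_inner_eq hT hK hle hz₀K (by rw [hmax, hnorm]; ring)
  exact absurd (hev z₀ hz₀K hnorm _ hT₀) (not_lt.2 hμc.le)

end Hilbert

namespace CDFBasis

open Filter Topology

variable {X A : Type*} {d : ℕ} (B : CDFBasis X A d) {n : ℕ} (x : Fin n → X) (a : Fin n → A)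

instance : TopologicalSpace.SeparableSpace B.L2 :=
  haveI : Fact ((2 : ENNReal) ≠ ⊤) := ⟨by norm_num⟩
  inferInstance

/-- The quadratic form of `𝒰_𝒟` is weakly sequentially continuous: the mixtures converge pointwise
and boundedly. -/
theorem tendsto_inner_designOp {z : ℕ → B.L2} {z₀ : B.L2} {R : ℝ} (hz : ∀ k, ‖z k‖ ≤ R)
    (hlim : ∀ v, Tendsto (fun k => inner ℝ (z k) v) atTop (𝓝 (inner ℝ z₀ v))) :
    Tendsto (fun k => inner ℝ (z k) (B.designOp x a (z k))) atTop
      (𝓝 (inner ℝ z₀ (B.designOp x a z₀))) := by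
  simp only [← B.inner_designOp_comm x a, inner_designOp, inner_opL]
  refine tendsto_finsetSum _ fun j _ => ?_
  refine tendsto_integral_of_dominated_convergence (fun _ => R * R) (fun k => ?_)
    (integrable_const _) (fun k => ?_) ?_
  · exact ((B.measurable_mixture _ _ _).mul (B.measurable_mixture _ _ _)).aestronglyMeasurable
  · refine Eventually.of_forall fun s => ?_
    have h := (B.abs_mixture_le (z k) (x j) (a j) s).trans (hz k)
    rw [Real.norm_eq_abs, abs_mul]
    exact mul_le_mul h h (abs_nonneg _) ((abs_nonneg _).trans h)
  · refine Eventually.of_forall fun s => ?_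
    have h : Tendsto (fun k => B.mixture (z k) (x j) (a j) s) atTop
        (𝓝 (B.mixture z₀ (x j) (a j) s)) := by
      simp only [mixture_eq_inner]
      exact hlim _
    exact h.mul h

theorem inner_indicatorConstLp_eq (θ : B.L2) {E : Set B.Om} (hE : MeasurableSet E) :
    inner ℝ θ (indicatorConstLp 2 hE (measure_ne_top B.nu E) (1 : ℝ)) = ∫ w in E, θ w ∂B.nu := by
  rw [real_inner_comm, L2.inner_indicatorConstLp_one]

theorem mem_coeffSet_of_tendsto_inner {M : ℝ} {z : ℕ → B.L2} {z₀ : B.L2}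
    (hz : ∀ k, z k ∈ B.coeffSet M) (hz₀ : ‖z₀‖ ≤ M)
    (hlim : ∀ v, Tendsto (fun k => inner ℝ (z k) v) atTop (𝓝 (inner ℝ z₀ v))) :
    z₀ ∈ B.coeffSet M := by
  have hset : ∀ E : Set B.Om, MeasurableSet E →
      Tendsto (fun k => ∫ w in E, z k w ∂B.nu) atTop (𝓝 (∫ w in E, z₀ w ∂B.nu)) := by
    intro E hE
    simp only [← B.inner_indicatorConstLp_eq _ hE]
    exact hlim _
  refine ⟨?_, ?_, hz₀⟩
  · refine ae_nonneg_of_forall_setIntegral_nonneg (integrable_of_L2 B.nu z₀) fun E hE _ => ?_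
    refine ge_of_tendsto' (hset E hE) fun k => ?_
    exact integral_nonneg_of_ae (ae_restrict_of_ae (hz k).1)
  · have h := hset Set.univ MeasurableSet.univ
    simp only [Measure.restrict_univ] at h
    exact tendsto_nhds_unique h (tendsto_const_nhds.congr fun k => (hz k).2.1.symm)

theorem sq_opNorm_designOp (θ : B.L2) :
    opNorm (B.designOp x a) θ ^ 2 = inner ℝ θ (B.designOp x a θ) :=
  Real.sq_sqrt (B.inner_designOp_self_nonneg x a θ)

theorem projections_nonempty {M : ℝ} (hM : (B.coeffSet M).Nonempty) (θ : B.L2) :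
    (B.projections M (B.designOp x a) θ).Nonempty := by
  set f : B.L2 → ℝ := fun z => opNorm (B.designOp x a) (z - θ) ^ 2 with hf
  have hbdd : BddBelow (f '' B.coeffSet M) := by
    refine ⟨0, ?_⟩
    rintro _ ⟨z, -, rfl⟩
    exact sq_nonneg _
  obtain ⟨t, -, ht, htS⟩ := exists_seq_tendsto_sInf (hM.image f) hbdd
  choose z hz hzt using htS
  obtain ⟨z₀, hz₀, φ, hφ, hlim⟩ := exists_subseq_tendsto_inner fun k => (hz k).2.2
  have hmem : z₀ ∈ B.coeffSet M := B.mem_coeffSet_of_tendsto_inner (fun k => hz (φ k)) hz₀ hlim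
  have hmin : f z₀ = sInf (f '' B.coeffSet M) := by
    have h := B.tendsto_inner_designOp x a (z := fun k => z (φ k) - θ) (z₀ := z₀ - θ)
      (R := M + ‖θ‖) (fun k => (norm_sub_le _ _).trans (add_le_add_left (hz (φ k)).2.2 _))
      (fun v => by
        simp only [inner_sub_left]
        exact (hlim v).sub_const _)
    simp only [← sq_opNorm_designOp] at h
    exact tendsto_nhds_unique h ((ht.comp hφ.tendsto_atTop).congr fun k => (hzt _).symm)
  exact ⟨z₀, hmem, fun z' hz' => hmin.trans_le (csInf_le hbdd ⟨z', hz', rfl⟩)⟩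

/-- Outside the span of the retained eigenfunctions, the quadratic form of `𝒰_𝒟` is at most the
truncation level. -/
theorem inner_designOp_le_of_orthogonal {c : ℝ} (hc : 0 < c)
    (hlt : ∃ N, eigenval (B.designOp x a) N < c) {e : ℕ → B.L2}
    (he : IsEigenfunctions (B.designOp x a) e) {u : B.L2}
    (hu : ∀ i < truncIndex (B.designOp x a) c, inner ℝ (e i) u = 0) :
    inner ℝ u (B.designOp x a u) ≤ c * ‖u‖ ^ 2 := by
  set T := B.designOp x a with hTdef
  set K : Submodule ℝ B.L2 :=
    Submodule.span ℝ (Set.range fun i : Fin (truncIndex T c) => e i) with hKdef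
  have hmem : ∀ v, v ∈ Kᗮ ↔ ∀ i < truncIndex T c, inner ℝ (e i) v = 0 := by
    intro v
    constructor
    · exact fun hv i hi => hv (e i) (Submodule.subset_span ⟨⟨i, hi⟩, rfl⟩)
    · intro hv
      have h : K ≤ (Submodule.span ℝ {v})ᗮ := by
        refine Submodule.span_le.2 ?_
        rintro _ ⟨i, rfl⟩
        rw [SetLike.mem_coe, Submodule.mem_orthogonal_singleton_iff_inner_left]
        exact hv i i.2
      exact fun k hk => Submodule.mem_orthogonal_singleton_iff_inner_left.1 (h hk)
  refine inner_le_of_eigenvalue_lt (B.inner_designOp_comm x a)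
    (fun z z₀ R hz hlim => B.tendsto_inner_designOp x a hz hlim) (K := K) ?_ hc.le ?_
    ((hmem u).2 hu)
  · intro v hv
    refine (hmem _).2 fun i hi => ?_
    rw [← B.inner_designOp_comm x a, ← hTdef, he.apply_eq, inner_smul_left,
      (hmem v).1 hv i hi, mul_zero]
  · intro v hv hv1 μ hμ
    refine eigenvalue_lt_of_orthogonal T hlt (e := e) ?_ (fun i _ => he.apply_eq i) hv1
      ((hmem v).1 hv) hμ
    exact he.orthonormal.comp
      (fun i : Fin (truncIndex T c) => (⟨i, (hc.trans_le
        (le_eigenval_of_lt_truncIndex T i.2)).ne'⟩ : {k : ℕ // eigenval T k ≠ 0}))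
      fun i j h => Fin.ext (congrArg Subtype.val h)

end CDFBasis

/-! ### Gaussian mixtures and sub-Gaussian noise -/

section GaussianMixture

open ProbabilityTheory

theorem integral_exp_sq_gaussianReal {l : ℝ} (hl : 0 ≤ l) :
    ∫ t, Real.exp (l * t ^ 2 / 2) ∂gaussianReal 0 (Real.toNNReal (1 / (1 + l))) =
      Real.exp (Real.log (1 + l) / 2) := by
  have hl1 : 0 < 1 + l := by linarith
  have hv : Real.toNNReal (1 / (1 + l)) ≠ 0 := by
    simpa using hl1
  have hvc : ((Real.toNNReal (1 / (1 + l)) : NNReal) : ℝ) = 1 / (1 + l) :=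
    Real.coe_toNNReal _ (by positivity)
  rw [integral_gaussianReal_eq_integral_smul hv]
  have h : ∀ t : ℝ, gaussianPDFReal 0 (Real.toNNReal (1 / (1 + l))) t • Real.exp (l * t ^ 2 / 2) =
      (Real.sqrt (2 * Real.pi * (1 / (1 + l))))⁻¹ * Real.exp (-(1 / 2) * t ^ 2) := by
    intro t
    rw [gaussianPDFReal, hvc, smul_eq_mul, mul_assoc, ← Real.exp_add]
    congr 2
    field_simp
    ring
  simp only [h]
  rw [integral_const_mul, integral_gaussian, ← Real.sqrt_inv, ← Real.sqrt_mul (by positivity),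
    Real.exp_half, Real.exp_log hl1]
  congr 1
  field_simp

theorem integrable_exp_sq_gaussianReal {l : ℝ} (hl : 0 ≤ l) :
    Integrable (fun t => Real.exp (l * t ^ 2 / 2))
      (gaussianReal 0 (Real.toNNReal (1 / (1 + l)))) :=
  Integrable.of_integral_ne_zero (by
    rw [integral_exp_sq_gaussianReal hl]
    exact (Real.exp_pos _).ne')

variable {ι : Type*} [Fintype ι]

theorem lintegral_exp_sum_pi (μ : ι → Measure ℝ) [∀ i, SigmaFinite (μ i)] (f : ι → ℝ → ℝ)
    (hf : ∀ i, Integrable (fun t => Real.exp (f i t)) (μ i)) :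
    ∫⁻ α : ι → ℝ, ENNReal.ofReal (Real.exp (∑ i, f i (α i))) ∂Measure.pi μ =
      ENNReal.ofReal (∏ i, ∫ t, Real.exp (f i t) ∂μ i) := by
  simp only [Real.exp_sum]
  rw [← integral_fintype_prod_eq_prod (𝕜 := ℝ) fun i t => Real.exp (f i t),
    ofReal_integral_eq_lintegral_ofReal]
  · exact Integrable.fintype_prod hf
  · exact Filter.Eventually.of_forall fun α => Finset.prod_nonneg fun i _ => (Real.exp_pos _).le

/-- Integrating the exponential moments against Gaussian weights of variances `1 / (1 + λ_i)`
turns linear exponents into squares. -/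
theorem lintegral_exp_sum_sq_le {Ω : Type*} [MeasurableSpace Ω] (P : Measure Ω)
    [IsProbabilityMeasure P] {η : ι → Ω → ℝ} (hη : ∀ i, Measurable (η i)) {l : ι → ℝ}
    (hl : ∀ i, 0 ≤ l i)
    (h : ∀ α : ι → ℝ, ∫⁻ ω, ENNReal.ofReal (Real.exp (∑ i, α i * η i ω)) ∂P ≤
      ENNReal.ofReal (Real.exp (∑ i, l i * α i ^ 2 / 2))) :
    ∫⁻ ω, ENNReal.ofReal (Real.exp ((∑ i, η i ω ^ 2 / (1 + l i)) / 2)) ∂P ≤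
      ENNReal.ofReal (Real.exp ((∑ i, Real.log (1 + l i)) / 2)) := by
  set G : ι → Measure ℝ := fun i => gaussianReal 0 (Real.toNNReal (1 / (1 + l i))) with hG
  have h1 : ∀ ω, ENNReal.ofReal (Real.exp ((∑ i, η i ω ^ 2 / (1 + l i)) / 2)) =
      ∫⁻ α : ι → ℝ, ENNReal.ofReal (Real.exp (∑ i, α i * η i ω)) ∂Measure.pi G := by
    intro ω
    have hmgf : ∀ i, ∫ t, Real.exp (t * η i ω) ∂G i = Real.exp (η i ω ^ 2 / (1 + l i) / 2) := by
      intro i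
      have := mgf_gaussianReal (p := G i) (X := id) (Measure.map_id) (η i ω)
      rw [mgf, Real.coe_toNNReal _ (by have := hl i; positivity)] at this
      simp only [id, mul_comm (η i ω)] at this
      rw [this]
      congr 1
      ring
    rw [lintegral_exp_sum_pi G (fun i t => t * η i ω) fun i =>
      Integrable.of_integral_ne_zero (by rw [hmgf]; exact (Real.exp_pos _).ne')]
    simp only [hmgf]
    rw [← Real.exp_sum, Finset.sum_div]
  simp only [h1]
  rw [lintegral_lintegral_swap (by fun_prop)]
  refine (lintegral_mono h).trans (le_of_eq ?_)
  rw [lintegral_exp_sum_pi G (fun i t => l i * t ^ 2 / 2)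
    fun i => integrable_exp_sq_gaussianReal (hl i)]
  simp only [hG, integral_exp_sq_gaussianReal (hl _)]
  rw [← Real.exp_sum, Finset.sum_div]

/-- Self-normalized tail bound for a vector which is sub-Gaussian with diagonal variance proxy
`l`. -/
theorem one_sub_le_measureReal_sum_sq_le {Ω : Type*} [MeasurableSpace Ω] (P : Measure Ω)
    [IsProbabilityMeasure P] {η : ι → Ω → ℝ} (hη : ∀ i, Measurable (η i)) {l : ι → ℝ}
    (hl : ∀ i, 0 ≤ l i)
    (h : ∀ α : ι → ℝ, ∫⁻ ω, ENNReal.ofReal (Real.exp (∑ i, α i * η i ω)) ∂P ≤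
      ENNReal.ofReal (Real.exp (∑ i, l i * α i ^ 2 / 2))) {δ : ℝ} (hδ : 0 < δ) :
    1 - δ ≤ P.real {ω | ∑ i, η i ω ^ 2 / (1 + l i) ≤
      2 * Real.log (1 / δ) + ∑ i, Real.log (1 + l i)} := by
  set s := {ω | ∑ i, η i ω ^ 2 / (1 + l i) ≤
      2 * Real.log (1 / δ) + ∑ i, Real.log (1 + l i)} with hs
  have hsm : MeasurableSet s := measurableSet_le (by fun_prop) measurable_const
  set E := Real.exp ((∑ i, Real.log (1 + l i)) / 2) with hE
  have hEpos : 0 < E := Real.exp_pos _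
  have hsub : sᶜ ⊆ {ω | ENNReal.ofReal (E / δ) ≤
      ENNReal.ofReal (Real.exp ((∑ i, η i ω ^ 2 / (1 + l i)) / 2))} := by
    intro ω hω
    simp only [hs, Set.mem_compl_iff, Set.mem_ofPred_eq, not_le] at hω
    refine ENNReal.ofReal_le_ofReal ?_
    rw [div_eq_mul_one_div, ← Real.exp_log (one_div_pos.2 hδ), hE, ← Real.exp_add]
    exact Real.exp_le_exp.2 (by linarith)
  have hmarkov := (mul_meas_ge_le_lintegral₀ (μ := P)
    (f := fun ω => ENNReal.ofReal (Real.exp ((∑ i, η i ω ^ 2 / (1 + l i)) / 2)))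
    (by fun_prop) (ENNReal.ofReal (E / δ))).trans (lintegral_exp_sum_sq_le P hη hl h)
  have h2 : ENNReal.ofReal (E / δ) * P sᶜ ≤ ENNReal.ofReal E :=
    (mul_le_mul_right (measure_mono hsub) _).trans hmarkov
  have h3 := ENNReal.toReal_mono ENNReal.ofReal_ne_top h2
  rw [ENNReal.toReal_mul, ENNReal.toReal_ofReal hEpos.le, ENNReal.toReal_ofReal (by positivity)]
    at h3
  have h4 : P.real sᶜ ≤ δ := by
    have : E / δ * P.real sᶜ ≤ E / δ * δ := by
      rw [div_mul_cancel₀ _ hδ.ne']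
      exact h3
    exact le_of_mul_le_mul_left this (by positivity)
  rw [probReal_compl_eq_one_sub hsm] at h4
  linarith

end GaussianMixture

namespace CDFBasis

open ProbabilityTheory

variable {X A : Type*} {d : ℕ} (B : CDFBasis X A d)

/-- `t ↦ ∫_S 𝟙{t ≤ s} (∫ β φ(x, a, ·, s) dν) dm(s)`, the contribution of an observation `t` to the
response function tested against `β`. -/
def score (x : X) (a : A) (β : B.L2) (t : ℝ) : ℝ :=
  ∫ s, (Set.Ici t).indicator 1 s * B.mixture β x a s ∂B.mS

variable (x : X) (a : A) (β : B.L2)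

theorem measurable_indicator_Ici :
    Measurable (Function.uncurry fun t s : ℝ => (Set.Ici t).indicator (1 : ℝ → ℝ) s) := by
  have : (Function.uncurry fun t s : ℝ => (Set.Ici t).indicator (1 : ℝ → ℝ) s) =
      {p : ℝ × ℝ | p.1 ≤ p.2}.indicator 1 := by
    funext p
    simp [Set.indicator, Function.uncurry]
  rw [this]
  exact measurable_one.indicator (measurableSet_le measurable_fst measurable_snd)

theorem measurable_score : Measurable (B.score x a β) := by
  have h : StronglyMeasurable (Function.uncurry fun t s : ℝ =>
      (Set.Ici t).indicator 1 s * B.mixture β x a s) :=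
    (measurable_indicator_Ici.mul
      ((B.measurable_mixture β x a).comp measurable_snd)).stronglyMeasurable
  exact h.integral_prod_right.measurable

theorem integrable_abs_mixture : Integrable (fun s => |B.mixture β x a s|) B.mS :=
  Integrable.of_bound (B.measurable_mixture β x a).abs.aestronglyMeasurable ‖β‖
    (Filter.Eventually.of_forall fun s => by simpa using B.abs_mixture_le β x a s)

theorem abs_indicator_mul_mixture_le (t s : ℝ) :
    |(Set.Ici t).indicator 1 s * B.mixture β x a s| ≤ |B.mixture β x a s| := by
  by_cases h : s ∈ Set.Ici t <;> simp [h]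

theorem abs_score_le (t : ℝ) : |B.score x a β t| ≤ ∫ s, |B.mixture β x a s| ∂B.mS := by
  rw [score, ← Real.norm_eq_abs]
  exact norm_integral_le_of_norm_le (B.integrable_abs_mixture x a β)
    (Filter.Eventually.of_forall fun s => B.abs_indicator_mul_mixture_le x a β t s)

theorem sq_integral_abs_mixture_le :
    (∫ s, |B.mixture β x a s| ∂B.mS) ^ 2 ≤ inner ℝ (B.opL x a β) β := by
  have hm : MemLp (fun s => |B.mixture β x a s|) 2 B.mS :=
    MemLp.of_bound (B.measurable_mixture β x a).abs.aestronglyMeasurable ‖β‖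
      (Filter.Eventually.of_forall fun s => by simpa using B.abs_mixture_le β x a s)
  have h := variance_nonneg (fun s => |B.mixture β x a s|) B.mS
  rw [variance_eq_sub hm] at h
  have h2 : ∫ s, ((fun s => |B.mixture β x a s|) ^ 2) s ∂B.mS = inner ℝ (B.opL x a β) β := by
    rw [inner_opL]
    refine integral_congr_ae (Filter.Eventually.of_forall fun s => ?_)
    simp [sq]
  rw [h2] at h
  linarith

variable {Ω : Type*} [MeasurableSpace Ω] (P : Measure Ω) [IsProbabilityMeasure P]

/-- The mean of the score of an observation whose distribution function is the mixture with
coefficients `θ`. -/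
theorem integral_score {Y : Ω → ℝ} (hY : Measurable Y) (θ : B.L2)
    (hcdf : ∀ s, P.real {ω | Y ω ≤ s} = B.mixture θ x a s) :
    ∫ ω, B.score x a β (Y ω) ∂P = inner ℝ (B.opL x a θ) β := by
  have hmeas : Measurable (Function.uncurry fun (ω : Ω) (s : ℝ) =>
      (Set.Ici (Y ω)).indicator 1 s * B.mixture β x a s) :=
    (measurable_indicator_Ici.comp ((hY.comp measurable_fst).prodMk measurable_snd)).mul
      ((B.measurable_mixture β x a).comp measurable_snd)
  have hint : Integrable (Function.uncurry fun (ω : Ω) (s : ℝ) =>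
      (Set.Ici (Y ω)).indicator 1 s * B.mixture β x a s) (P.prod B.mS) :=
    Integrable.of_bound hmeas.aestronglyMeasurable ‖β‖ (Filter.Eventually.of_forall fun p =>
      (B.abs_indicator_mul_mixture_le x a β _ _).trans (B.abs_mixture_le β x a _))
  simp only [score]
  rw [integral_integral_swap hint, inner_opL]
  refine integral_congr_ae (Filter.Eventually.of_forall fun s => ?_)
  simp only
  rw [integral_mul_const, ← hcdf]
  congr 1
  have : (fun ω => (Set.Ici (Y ω)).indicator (1 : ℝ → ℝ) s) = {ω | Y ω ≤ s}.indicator 1 := by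
    funext ω
    simp [Set.indicator]
  rw [this, integral_indicator_one (measurableSet_le hY measurable_const)]

/-- Hoeffding's lemma for the score: it lies in an interval of length at most
`2 ⟨β, ℒ^{x,a} β⟩^{1/2}`. -/
theorem hasSubgaussianMGF_score {Y : Ω → ℝ} (hY : Measurable Y) (θ : B.L2)
    (hcdf : ∀ s, P.real {ω | Y ω ≤ s} = B.mixture θ x a s) :
    HasSubgaussianMGF (fun ω => B.score x a β (Y ω) - inner ℝ (B.opL x a θ) β)
      (Real.toNNReal (inner ℝ (B.opL x a β) β)) P := by
  set D := ∫ s, |B.mixture β x a s| ∂B.mS with hD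
  have h := hasSubgaussianMGF_of_mem_Icc (μ := P) (X := fun ω => B.score x a β (Y ω))
    (a := -D) (b := D) ((B.measurable_score x a β).comp hY).aemeasurable
    (Filter.Eventually.of_forall fun ω => abs_le.1 (B.abs_score_le x a β (Y ω)))
  rw [B.integral_score x a β P hY θ hcdf] at h
  refine ⟨h.integrable_exp_mul, fun t => (h.mgf_le t).trans (Real.exp_le_exp.2 ?_)⟩
  have h2 : (((‖D - -D‖₊ / 2) ^ 2 : NNReal) : ℝ) = D ^ 2 := by
    push_cast
    rw [Real.norm_eq_abs, div_pow, sq_abs]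
    ring
  rw [h2, Real.coe_toNNReal _ (B.inner_opL_self_nonneg x a β)]
  have := mul_le_mul_of_nonneg_right (B.sq_integral_abs_mixture_le x a β) (sq_nonneg t)
  linarith

/-- The noise in the response function is sub-Gaussian with variance proxy `𝒰_𝒟`. -/
theorem lintegral_exp_inner_noise_le {n : ℕ} (x : Fin n → X) (a : Fin n → A)
    {y : Fin n → Ω → ℝ} (hy : ∀ j, Measurable (y j)) (hind : iIndepFun y P) (θ : B.L2)
    (hcdf : ∀ j s, P.real {ω | y j ω ≤ s} = B.mixture θ (x j) (a j) s) :
    ∫⁻ ω, ENNReal.ofReal (Real.exp (inner ℝ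
      ((B.memLp_responseFun x a fun j => y j ω).toLp _ - B.designOp x a θ) β)) ∂P ≤
      ENNReal.ofReal (Real.exp (inner ℝ β (B.designOp x a β) / 2)) := by
  have h := HasSubgaussianMGF.sum_of_iIndepFun (s := Finset.univ)
    (X := fun j ω => B.score (x j) (a j) β (y j ω) - inner ℝ (B.opL (x j) (a j) θ) β)
    (hind.comp (fun j t => B.score (x j) (a j) β t - inner ℝ (B.opL (x j) (a j) θ) β)
      fun j => (B.measurable_score _ _ _).sub_const _)
    fun j _ => B.hasSubgaussianMGF_score (x j) (a j) β P (hy j) θ (hcdf j)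
  have heq : ∀ ω, inner ℝ
      ((B.memLp_responseFun x a fun j => y j ω).toLp _ - B.designOp x a θ) β =
      ∑ j, (B.score (x j) (a j) β (y j ω) - inner ℝ (B.opL (x j) (a j) θ) β) := fun ω => by
    rw [inner_sub_left, inner_responseFun, inner_designOp, Finset.sum_sub_distrib]
    rfl
  have hi := h.integrable_exp_mul 1
  have hb := h.mgf_le 1
  simp only [mgf, one_mul] at hi hb
  simp only [heq]
  rw [← ofReal_integral_eq_lintegral_ofReal hi
    (Filter.Eventually.of_forall fun _ => (Real.exp_pos _).le)]
  refine ENNReal.ofReal_le_ofReal (hb.trans (le_of_eq ?_))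
  rw [← B.inner_designOp_comm x a, inner_designOp]
  push_cast
  simp [Real.coe_toNNReal _ (B.inner_opL_self_nonneg _ _ β)]

end CDFBasis

/-! ### Projections and the truncated estimate -/

namespace CDFBasis

open ProbabilityTheory

variable {X A : Type*} {d : ℕ} (B : CDFBasis X A d)

theorem convex_coeffSet (M : ℝ) : Convex ℝ (B.coeffSet M) := by
  rintro θ ⟨hθ0, hθ1, hθM⟩ η ⟨hη0, hη1, hηM⟩ s t hs ht hst
  have hcoe : (↑(s • θ + t • η) : B.Om → ℝ) =ᵐ[B.nu] fun w => s * θ w + t * η w := by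
    filter_upwards [Lp.coeFn_add (s • θ) (t • η), Lp.coeFn_smul s θ, Lp.coeFn_smul t η]
      with w h1 h2 h3
    rw [h1, Pi.add_apply, h2, h3]
    rfl
  refine ⟨?_, ?_, ?_⟩
  · filter_upwards [hcoe, hθ0, hη0] with w h h1 h2
    rw [h]
    exact add_nonneg (mul_nonneg hs h1) (mul_nonneg ht h2)
  · rw [integral_congr_ae hcoe, integral_add ((integrable_of_L2 B.nu θ).const_mul s)
      ((integrable_of_L2 B.nu η).const_mul t), integral_const_mul, integral_const_mul, hθ1, hη1]
    linarith
  · have h := convex_closedBall (0 : B.L2) M (x := θ) (by simpa using hθM) (y := η)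
      (by simpa using hηM) hs ht hst
    simpa using h

variable {n : ℕ} (x : Fin n → X) (a : Fin n → A)

theorem inner_designOp_add_smul (u v : B.L2) (t : ℝ) :
    inner ℝ (u + t • v) (B.designOp x a (u + t • v)) =
      inner ℝ u (B.designOp x a u) + 2 * t * inner ℝ u (B.designOp x a v) +
        t ^ 2 * inner ℝ v (B.designOp x a v) := by
  have h : inner ℝ v (B.designOp x a u) = inner ℝ u (B.designOp x a v) := by
    rw [← B.inner_designOp_comm x a v u, real_inner_comm]
  simp only [map_add, map_smul, inner_add_left, inner_add_right, inner_smul_left,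
    inner_smul_right, conj_trivial, h]
  ring

/-- Projecting onto a convex set does not increase the seminorm distance to its points. -/
theorem opNorm_projection_sub_le {M : ℝ} {θ z θstar : B.L2}
    (hz : z ∈ B.projections M (B.designOp x a) θ) (hθ : θstar ∈ B.coeffSet M) :
    opNorm (B.designOp x a) (z - θstar) ≤ opNorm (B.designOp x a) (θ - θstar) := by
  obtain ⟨hzC, hmin⟩ := hz
  set b := inner ℝ (z - θ) (B.designOp x a (θstar - z)) with hb
  set q := inner ℝ (θstar - z) (B.designOp x a (θstar - z)) with hq
  have hq0 : 0 ≤ q := B.inner_designOp_self_nonneg x a _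
  have hineq : ∀ t : ℝ, 0 ≤ t → t ≤ 1 → 0 ≤ 2 * t * b + t ^ 2 * q := by
    intro t ht0 ht1
    have h1 := hmin _ ((B.convex_coeffSet M).add_smul_sub_mem hzC hθ ⟨ht0, ht1⟩)
    rw [show z + t • (θstar - z) - θ = z - θ + t • (θstar - z) by abel, sq_opNorm_designOp,
      sq_opNorm_designOp, inner_designOp_add_smul] at h1
    linarith
  have hb0 : 0 ≤ b := by
    by_contra! hlt
    -- at this step length the linear term dominates the quadratic one
    set t := -b / (q - b) with ht
    have hden : 0 < q - b := by linarith
    have ht0 : 0 < t := div_pos (by linarith) hden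
    have ht1 : t ≤ 1 := by
      rw [ht, div_le_one hden]
      linarith
    have h1 := hineq t ht0.le ht1
    have h2 : t * q = -b + t * b := by
      rw [ht]
      field_simp
      ring
    nlinarith [mul_pos ht0 (neg_pos.2 hlt)]
  refine Real.sqrt_le_sqrt ?_
  have h1 := B.inner_designOp_add_smul x a (z - θ) (θstar - z) 1
  rw [show z - θ + (1 : ℝ) • (θstar - z) = -(θ - θstar) by rw [one_smul]; abel] at h1
  rw [← neg_sub θstar z]
  simp only [map_neg, inner_neg_neg] at h1 ⊢
  linarith [B.inner_designOp_self_nonneg x a (z - θ)]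

theorem inner_sum_smul_eigenfunctions {c : ℝ} (hc : 0 < c) {e : ℕ → B.L2}
    (he : IsEigenfunctions (B.designOp x a) e) (w : ℕ → ℝ) {i : ℕ}
    (hi : i < truncIndex (B.designOp x a) c) :
    inner ℝ (e i) (∑ j ∈ Finset.range (truncIndex (B.designOp x a) c), w j • e j) = w i := by
  have hne : ∀ k < truncIndex (B.designOp x a) c, eigenval (B.designOp x a) k ≠ 0 :=
    fun k hk => (hc.trans_le (le_eigenval_of_lt_truncIndex _ hk)).ne'
  rw [inner_sum, Finset.sum_eq_single_of_mem i (Finset.mem_range.2 hi)]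
  · have h : ‖e i‖ = 1 := he.orthonormal.1 ⟨i, hne i hi⟩
    rw [inner_smul_right, real_inner_self_eq_norm_sq, h]
    ring
  · intro j hj hji
    have h : inner ℝ (e i) (e j) = 0 :=
      he.orthonormal.2 (i := ⟨i, hne i hi⟩) (j := ⟨j, hne j (Finset.mem_range.1 hj)⟩)
        fun h => hji (congrArg Subtype.val h).symm
    rw [inner_smul_right, h, mul_zero]

/-- The squared error of the truncated least squares estimate splits orthogonally into a variance
term, carried by the retained eigenfunctions, and a bias term. -/
theorem inner_truncPinv_sub_le {c : ℝ} (hc : 0 < c)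
    (hlt : ∃ N, eigenval (B.designOp x a) N < c) {e : ℕ → B.L2}
    (he : IsEigenfunctions (B.designOp x a) e) (g θ : B.L2) :
    inner ℝ (truncPinv (B.designOp x a) e c g - θ)
        (B.designOp x a (truncPinv (B.designOp x a) e c g - θ)) ≤
      ∑ i ∈ Finset.range (truncIndex (B.designOp x a) c),
        inner ℝ (g - B.designOp x a θ) (e i) ^ 2 / eigenval (B.designOp x a) i +
      c * ‖θ‖ ^ 2 := by
  set T := B.designOp x a with hT
  set I := Finset.range (truncIndex T c) with hI
  have hpos : ∀ i ∈ I, 0 < eigenval T i := fun i hi =>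
    hc.trans_le (le_eigenval_of_lt_truncIndex T (Finset.mem_range.1 hi))
  set η : ℕ → ℝ := fun i => inner ℝ (g - T θ) (e i) with hη
  set v := ∑ i ∈ I, (η i / eigenval T i) • e i with hv
  set p := ∑ i ∈ I, (inner ℝ (e i) θ : ℝ) • e i with hp
  set r := p - θ with hr
  have hsplit : truncPinv T e c g - θ = v + (1 : ℝ) • r := by
    have : truncPinv T e c g = v + p := by
      rw [truncPinv, hv, hp, ← Finset.sum_add_distrib]
      refine Finset.sum_congr rfl fun i hi => ?_
      rw [← add_smul]
      congr 1
      have h1 : η i = inner ℝ g (e i) - eigenval T i * inner ℝ (e i) θ := by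
        rw [hη]
        simp only
        rw [inner_sub_left, B.inner_designOp_comm x a, ← hT, he.apply_eq, inner_smul_right,
          real_inner_comm θ]
      rw [h1]
      have := (hpos i hi).ne'
      field_simp
      ring
    rw [this, one_smul, hr]
    abel
  have hrorth : ∀ i ∈ I, inner ℝ (e i) r = 0 := by
    intro i hi
    rw [hr, inner_sub_right, hp,
      B.inner_sum_smul_eigenfunctions x a hc he _ (Finset.mem_range.1 hi), sub_self]
  have hTv : T v = ∑ i ∈ I, η i • e i := by
    rw [hv, map_sum]
    refine Finset.sum_congr rfl fun i hi => ?_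
    rw [map_smul, he.apply_eq, smul_smul, div_mul_cancel₀ _ (hpos i hi).ne']
  have hcross : inner ℝ v (T r) = 0 := by
    rw [← B.inner_designOp_comm x a, ← hT, hTv, sum_inner]
    exact Finset.sum_eq_zero fun i hi => by rw [inner_smul_left, hrorth i hi, mul_zero]
  have hvv : inner ℝ v (T v) = ∑ i ∈ I, η i ^ 2 / eigenval T i := by
    rw [hTv, inner_sum]
    refine Finset.sum_congr rfl fun i hi => ?_
    rw [inner_smul_right, real_inner_comm, hv,
      B.inner_sum_smul_eigenfunctions x a hc he _ (Finset.mem_range.1 hi)]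
    ring
  have hrr : inner ℝ r (T r) ≤ c * ‖θ‖ ^ 2 := by
    refine (B.inner_designOp_le_of_orthogonal x a hc hlt he
      fun i hi => hrorth i (Finset.mem_range.2 hi)).trans ?_
    refine mul_le_mul_of_nonneg_left ?_ hc.le
    have hpr : inner ℝ p r = 0 := by
      rw [hp, sum_inner]
      exact Finset.sum_eq_zero fun i hi => by rw [inner_smul_left, hrorth i hi, mul_zero]
    have h := norm_sub_sq_real p r
    rw [hpr, hr, sub_sub_cancel] at h
    linarith [sq_nonneg ‖p‖]
  rw [hsplit, B.inner_designOp_add_smul, ← hT, hcross, hvv]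
  linarith

variable {B x a} {γ s₀ M : ℝ} {τ : ℕ → ℝ}

/-- The deterministic part of the oracle inequality: control of the noise along the retained
eigenfunctions bounds the error of every projected estimate. -/
theorem DominatingEigendecay.opNorm_sub_le_errorD (hτ : B.DominatingEigendecay γ s₀ τ)
    (hn : 0 < n) {δ : ℝ} (hδ0 : 0 < δ) (hδ1 : δ ≤ 1) {θstar : B.L2} (hθ : θstar ∈ B.coeffSet M)
    {e : ℕ → B.L2} (he : IsEigenfunctions (B.designOp x a) e) {y : Fin n → ℝ} {θhat : B.L2}
    (hhat : θhat ∈ B.projections M (B.designOp x a) (B.thetaD γ x a e y))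
    (hnoise : ∑ i : Fin (truncIndex (B.designOp x a) (n * epsStar n γ)),
      inner ℝ ((B.memLp_responseFun x a y).toLp _ - B.designOp x a θstar) (e i) ^ 2 /
        (1 + eigenval (B.designOp x a) i) ≤
      2 * Real.log (1 / δ) + ∑ i : Fin (truncIndex (B.designOp x a) (n * epsStar n γ)),
        Real.log (1 + eigenval (B.designOp x a) i)) :
    opNorm (B.designOp x a) (θhat - θstar) ≤ B.errorD γ M δ x a := by
  refine (B.opNorm_projection_sub_le x a hhat hθ).trans ?_
  have hc1 := one_le_natCast_mul_epsStar hn hτ.gamma_pos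
  have hceq := natCast_mul_epsStar hn hτ.gamma_pos
  set g := (B.memLp_responseFun x a y).toLp _ with hg
  rw [errorD, ← hceq]
  simp only [Finset.sum_range]
  set c := n * epsStar n γ with hc
  have hc0 : 0 < c := zero_lt_one.trans_le hc1
  have hM : 0 ≤ M := (norm_nonneg _).trans hθ.2.2
  have hL : 0 ≤ Real.log (1 / δ) := Real.log_nonneg (by rw [le_div_iff₀ hδ0]; simpa using hδ1)
  have hS : 0 ≤ ∑ i : Fin (truncIndex (B.designOp x a) c),
      Real.log (1 + eigenval (B.designOp x a) i) :=
    Finset.sum_nonneg fun i _ => Real.log_nonneg (by linarith [eigenval_nonneg (B.designOp x a) i])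
  have hmain := B.inner_truncPinv_sub_le x a hc0 (hτ.exists_eigenval_designOp_lt hn hc0) he g θstar
  rw [Finset.sum_range] at hmain
  -- the retained eigenvalues are at least one, so that `1 / λ ≤ 2 / (1 + λ)`
  have hvar : ∑ i : Fin (truncIndex (B.designOp x a) c),
      inner ℝ (g - B.designOp x a θstar) (e i) ^ 2 / eigenval (B.designOp x a) i ≤
      2 * ∑ i : Fin (truncIndex (B.designOp x a) c),
        inner ℝ (g - B.designOp x a θstar) (e i) ^ 2 / (1 + eigenval (B.designOp x a) i) := by
    rw [Finset.mul_sum]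
    refine Finset.sum_le_sum fun i _ => ?_
    have h1 := hc1.trans (le_eigenval_of_lt_truncIndex (B.designOp x a) i.2)
    rw [← mul_div_assoc, div_le_div_iff₀ (by linarith) (by linarith)]
    nlinarith [sq_nonneg (inner ℝ (g - B.designOp x a θstar) (e i))]
  have hbias : c * ‖θstar‖ ^ 2 ≤ (c * M) ^ 2 := by
    have h1 : ‖θstar‖ ^ 2 ≤ M ^ 2 := pow_le_pow_left₀ (norm_nonneg _) hθ.2.2 2
    calc c * ‖θstar‖ ^ 2 ≤ c * M ^ 2 := mul_le_mul_of_nonneg_left h1 hc0.le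
      _ ≤ c * c * M ^ 2 := mul_le_mul_of_nonneg_right (le_mul_of_one_le_left hc0.le hc1)
          (sq_nonneg M)
      _ = _ := by ring
  rw [opNorm, Real.sqrt_le_iff]
  refine ⟨by positivity, ?_⟩
  rw [add_sq, Real.sq_sqrt (by positivity)]
  have hcr : 0 ≤ 2 * Real.sqrt (2 * (2 * Real.log (1 / δ) +
      ∑ i : Fin (truncIndex (B.designOp x a) c),
        Real.log (1 + eigenval (B.designOp x a) i))) * (c * M) := by positivity
  rw [thetaD]
  linarith

/-- The noise along the retained eigenfunctions is controlled with probability at least `1 - δ`. -/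
theorem one_sub_le_measureReal_noise {Ω : Type*} [MeasurableSpace Ω] (P : Measure Ω)
    [IsProbabilityMeasure P] {y : Fin n → Ω → ℝ} (hy : ∀ j, Measurable (y j))
    (hind : iIndepFun y P) {θ : B.L2}
    (hcdf : ∀ j s, P.real {ω | y j ω ≤ s} = B.mixture θ (x j) (a j) s)
    {e : ℕ → B.L2} (he : IsEigenfunctions (B.designOp x a) e) {c δ : ℝ} (hc : 0 < c)
    (hδ : 0 < δ) :
    1 - δ ≤ P.real {ω | ∑ i : Fin (truncIndex (B.designOp x a) c),
      inner ℝ ((B.memLp_responseFun x a fun j => y j ω).toLp _ - B.designOp x a θ) (e i) ^ 2 /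
        (1 + eigenval (B.designOp x a) i) ≤
      2 * Real.log (1 / δ) + ∑ i : Fin (truncIndex (B.designOp x a) c),
        Real.log (1 + eigenval (B.designOp x a) i)} := by
  refine one_sub_le_measureReal_sum_sq_le P
    (η := fun (i : Fin (truncIndex (B.designOp x a) c)) ω =>
      inner ℝ ((B.memLp_responseFun x a fun j => y j ω).toLp _ - B.designOp x a θ) (e i))
    (l := fun i => eigenval (B.designOp x a) i) (fun i => ?_)
    (fun i => eigenval_nonneg _ _) ?_ hδ
  · simp only [inner_sub_left, inner_responseFun]
    exact (Finset.measurable_sum _ fun j _ =>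
      (B.measurable_score (x j) (a j) (e i)).comp (hy j)).sub_const _
  · set N := truncIndex (B.designOp x a) c with hN
    intro α
    -- extend `α` by zero to use sums over a range of natural numbers
    set w : ℕ → ℝ := fun i => if h : i < N then α ⟨i, h⟩ else 0 with hw
    have hwα : ∀ i : Fin N, w i = α i := fun i => by simp [hw]
    set β := ∑ i ∈ Finset.range N, w i • e i with hβ
    have h := B.lintegral_exp_inner_noise_le β P x a hy hind θ hcdf
    have h1 : ∀ f : B.L2, inner ℝ f β = ∑ i : Fin N, α i * inner ℝ f (e i) := fun f => by
      rw [hβ, inner_sum, Finset.sum_range]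
      simp only [inner_smul_right, hwα]
    have h2 : inner ℝ β (B.designOp x a β) / 2 =
        ∑ i : Fin N, eigenval (B.designOp x a) i * α i ^ 2 / 2 := by
      rw [← B.inner_designOp_comm x a, h1, Finset.sum_div]
      refine Finset.sum_congr rfl fun i _ => ?_
      rw [B.inner_designOp_comm x a, he.apply_eq, inner_smul_right, real_inner_comm, hβ,
        B.inner_sum_smul_eigenfunctions x a hc he w i.2, hwα]
      ring
    rw [h2] at h
    simp only [h1] at h
    exact h

end CDFBasis

end FunctionalRegression

end

theorem mainTheorem4 {X A : Type*} [Finite A] {d : ℕ}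
    (B : FunctionalRegression.CDFBasis X A d)
    (γ s₀ M : ℝ) (τ : ℕ → ℝ) (hτ : B.DominatingEigendecay γ s₀ τ)
    (n : ℕ) (hn : 0 < n) (x : Fin n → X) (a : Fin n → A)
    (δ : ℝ) (hδ0 : 0 < δ) (hδ1 : δ ≤ 1) :
    -- the eigenvalues of the design operator are dominated by `n τ`
    (∀ k, FunctionalRegression.eigenval (B.designOp x a) k ≤ n * τ k) ∧
    -- the data-dependent error term is bounded independently of the dataset
    B.errorD γ M δ x a ≤ FunctionalRegression.errorBound γ s₀ M δ n ∧
    -- the oracle inequality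
    ∀ (θstar : B.L2), θstar ∈ B.coeffSet M →
    ∀ {Ω : Type*} [MeasurableSpace Ω] (P : Measure Ω) [IsProbabilityMeasure P]
      (y : Fin n → Ω → ℝ), (∀ j, Measurable (y j)) → ProbabilityTheory.iIndepFun y P →
      (∀ j s, P.real {ω | y j ω ≤ s} = B.mixture θstar (x j) (a j) s) →
      ∀ e : ℕ → B.L2, FunctionalRegression.IsEigenfunctions (B.designOp x a) e →
        (∀ ω, (B.projections M (B.designOp x a)
          (B.thetaD γ x a e (fun j => y j ω))).Nonempty) ∧
        ∀ θhat : Ω → B.L2,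
          (∀ ω, θhat ω ∈ B.projections M (B.designOp x a)
            (B.thetaD γ x a e (fun j => y j ω))) →
          1 - δ ≤ P.real {ω | FunctionalRegression.opNorm (B.designOp x a) (θhat ω - θstar) ≤
            FunctionalRegression.errorBound γ s₀ M δ n} := by
  refine ⟨hτ.eigenval_designOp_le hn, hτ.errorD_le hn M hδ0 hδ1, ?_⟩
  intro θstar hθ Ω _ P _ y hy hind hcdf e he
  refine ⟨fun ω => B.projections_nonempty x a ⟨θstar, hθ⟩ _, fun θhat hhat => ?_⟩
  have hc : 0 < n * FunctionalRegression.CDFBasis.epsStar n γ :=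
    mul_pos (Nat.cast_pos.2 hn) (FunctionalRegression.CDFBasis.epsStar_pos hn γ)
  refine (FunctionalRegression.CDFBasis.one_sub_le_measureReal_noise P hy hind hcdf he hc
    hδ0).trans (measureReal_mono fun ω hω => ?_)
  exact (hτ.opNorm_sub_le_errorD hn hδ0 hδ1 hθ he (hhat ω) hω).trans
    (hτ.errorD_le hn M hδ0 hδ1)
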